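/- Let $a>0$, let $q:\mathbb R\to\mathbb R$ be $a$-periodic with $q\in L_1(0,a)$, let $q_1\in L_1(\mathbb R_+)$ be real, $c,\omega,\delta\in\mathbb R$, $\gamma\in(\tfrac12,1]$, $\alpha\in[0,\pi)$, and assume $\frac{2a\omega}{\pi}\notin\mathbb Z$. **Periodic background.** Let $\lambda_0\le\lambda_1\le\dots$ and $\mu_0\le\mu_1\le\dots$ be the eigenvalues (with multiplicity) of $-\psi''+q\psi=\lambda\psi$ on $[0,a]$ with periodic, respectively antiperiodic, boundary conditions, and let $$\sigma:=\bigcup_{n\ge0}\big([\lambda_{2n},\mu_{2n}]\cup[\mu_{2n+1},\lambda_{2n+1}]\big),\qquad \sigma^\circ:=\sigma\setminus\{\lambda_n,\mu_n:n\ge0\}.$$ Let $D(\lambda)$ be the monodromy matrix of the equation over one period and let $k$ be the quasi-momentum, i.e. the branch of $-i\ln\frac{\operatorname{tr}D+\sqrt{\operatorname{tr}^2D-4}}2$ (so $2\cos k=\operatorname{tr}D$) that is continuous on $\overline{\mathbb C_+}$, analytic in $\mathbb C_+$, maps $\mathbb C_+$ into $\mathbb C_+$, is real on $\sigma$ and satisfies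 $k(\lambda_0)=0$, $k(\mu_{2n})=k(\mu_{2n+1})=(2n+1)\pi$, $k(\lambda_{2n+1})=k(\lambda_{2n+2})=(2n+2)\pi$ for $n\ge0$. Let $\psi_\pm(x,\lambda)$, $x\ge0$, $\lambda\in\mathbb C_+\cup\sigma^\circ$, be Bloch solutions: $-\psi_\pm''+q\psi_\pm=\lambda\psi_\pm$, $\psi_\pm(x+a,\lambda)=e^{\pm ik(\lambda)}\psi_\pm(x,\lambda)$, normalized in any way such that: for every $x\ge 0$, $\psi_\pm(x,\cdot)$ and the Wronskian $W=\psi_+'\psi_--\psi_+\psi_-'$ are analytic in $\mathbb C_+$ and continuous on $\mathbb C_+\cup\sigma^\circ$; $\psi_+=\overline{\psi_-}$ on $\sigma^\circ$; $W$ has no zeros on $\mathbb C_+\cup\sigma^\circ$, and $W\in i(0,\infty)$ on $\sigma^\circ$. **Exceptional points and the sets $U(\beta)$.** With $\{\cdot\}$ the fractional part, the critical points $\lambda_n^\pm\in\sigma$, $n\ge0$, are given by $k(\lambda_n^+)=\pi(n+1-\{\frac{a\omega}\pi\})$ and $k(\lambda_n^-)=\pi(n+\{\frac{a\omega}\pi\})$.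 Put $\sigma^*:=\sigma^\circ\setminus\{\lambda_n^+,\lambda_n^-:n\ge0\}$, $$\varepsilon(\lambda):=\tfrac12\min_{n\in\mathbb Z}\min\Big\{\Big|\tfrac{2k(\lambda)}a+2\omega+\tfrac{2\pi n}a\Big|,\Big|\tfrac{2k(\lambda)}a-2\omega+\tfrac{2\pi n}a\Big|\Big\},$$ and for $\beta>0$, $\mu\in\sigma^*$, $$U(\beta,\mu):=\{\lambda\in\overline{\mathbb C_+}:\ 2\varepsilon(\lambda)\ge\varepsilon(\mu),\ 0\le\operatorname{Im}\tfrac{2k(\lambda)}a\le1,\ |\operatorname{Re}k(\lambda)-k(\mu)|\le\beta\operatorname{Im}k(\lambda)\},\qquad U(\beta):=\bigcup_{\mu\in\sigma^*}U(\beta,\mu).$$ **Theorem.** Let $\varphi_\alpha(x,\lambda)$, $x\ge 0$, be the solution of $$-\varphi_\alpha''+\Big(q(x)+\frac{c\sin(2\omega x+\delta)}{(x+1)^\gamma}+q_1(x)\Big)\varphi_\alpha=\lambda\varphi_\alpha,\qquad \varphi_\alpha(0,\lambda)=\sin\alpha,\quad\varphi_\alpha'(0,\lambda)=\cos\alpha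 .$$ There is a function $A_\alpha$ (the same for all $\beta>0$) such that, with primes denoting $x$-derivatives and as $x\to\infty$: 1. for every $\beta>0$ and every $\lambda\in\mathbb C_+\cap U(\beta)$, $$\varphi_\alpha(x,\lambda)=A_\alpha(\lambda)\psi_-(x,\lambda)+o\big(e^{\operatorname{Im}k(\lambda)\frac xa}\big),\qquad \varphi_\alpha'(x,\lambda)=A_\alpha(\lambda)\psi_-'(x,\lambda)+o\big(e^{\operatorname{Im}k(\lambda)\frac xa}\big);$$ 2. for every $\lambda\in\sigma^*$, $$\varphi_\alpha(x,\lambda)=A_\alpha(\lambda)\psi_-(x,\lambda)+\overline{A_\alpha(\lambda)}\psi_+(x,\lambda)+o(1),\qquad \varphi_\alpha'(x,\lambda)=A_\alpha(\lambda)\psi_-'(x,\lambda)+\overline{A_\alpha(\lambda)}\psi_+'(x,\lambda)+o(1);$$ 3. for every $\beta>0$, $A_\alpha$ is analytic in the interior of $U(\beta)$; and $A_\alpha$ has non-tangential boundary values on $\sigma^*$, equal to its values there: for all $\mu\in\sigma^*$ and $M>0$, $A_\alpha(\lambda)\to A_\alpha(\mu)$ as $\lambda\to\mu$ with $\operatorname{Im}\lambda>0$,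 $|\operatorname{Re}\lambda-\mu|\le M\operatorname{Im}\lambda$. -/

import Mathlib

open Filter Topology Asymptotics MeasureTheory Set

noncomputable section

/-- `f` is a (Carathéodory) solution of `-f'' + V f = z f` on the half-line `[0, ∞)` with
derivative `f'`: `f` is differentiable with derivative `f'`, and `f'` is the absolutely continuous
function with `(f')' = (V - z) f` almost everywhere, written in integrated form. -/
def IsSchrodingerSolution (V : ℝ → ℝ) (z : ℂ) (f f' : ℝ → ℂ) : Prop :=
  (∀ x : ℝ, 0 ≤ x → HasDerivWithinAt f (f' x) (Ici 0) x) ∧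
  ∀ x : ℝ, 0 ≤ x → f' x = f' 0 + ∫ t in (0 : ℝ)..x, ((V t : ℂ) - z) * f t

/-- `D` is the monodromy matrix over one period: it sends the Cauchy data at `0` of every solution
of `-f'' + q f = z f` to its Cauchy data at `a`. -/
def IsMonodromyMatrix (q : ℝ → ℝ) (a : ℝ) (z : ℂ) (D : Matrix (Fin 2) (Fin 2) ℂ) : Prop :=
  ∀ f f' : ℝ → ℂ, IsSchrodingerSolution q z f f' →
    D.mulVec ![f 0, f' 0] = ![f a, f' a]

/-- The multiplicity of the real number `t` as an eigenvalue of `-f'' + q f = t f` on `[0, a]`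
with boundary conditions `f a = s f 0`, `f' a = s f' 0` (`s = 1`: periodic, `s = -1`:
antiperiodic). Eigenfunctions are identified with their Cauchy data at `0`; the multiplicity is
`0` if `t` is not an eigenvalue. -/
def eigenMultiplicity (q : ℝ → ℝ) (a : ℝ) (s : ℂ) (t : ℝ) : ℕ :=
  Set.finrank ℂ {p : ℂ × ℂ | ∃ f f' : ℝ → ℂ, IsSchrodingerSolution q t f f' ∧
    f 0 = p.1 ∧ f' 0 = p.2 ∧ f a = s * f 0 ∧ f' a = s * f' 0}

/-- `e 0 ≤ e 1 ≤ e 2 ≤ …` lists all the eigenvalues of the above boundary value problem, each of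
them repeated according to its multiplicity. -/
def IsEigenvalueSequence (q : ℝ → ℝ) (a : ℝ) (s : ℂ) (e : ℕ → ℝ) : Prop :=
  Monotone e ∧ ∀ t : ℝ, {n : ℕ | e n = t}.encard = (eigenMultiplicity q a s t : ℕ∞)

/-- The spectrum of the periodic operator: the union of the bands
`[l (2 n), m (2 n)]` and `[m (2 n + 1), l (2 n + 1)]`, where `l` and `m` are the sequences of
periodic and of antiperiodic eigenvalues. -/
def bandSpectrum (l m : ℕ → ℝ) : Set ℝ :=
  ⋃ n : ℕ, Icc (l (2 * n)) (m (2 * n)) ∪ Icc (m (2 * n + 1)) (l (2 * n + 1))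

/-- The spectrum of the periodic operator without the band edges. -/
def bandInterior (l m : ℕ → ℝ) : Set ℝ :=
  bandSpectrum l m \ (range l ∪ range m)

/-- The open upper half-plane. -/
def upperHalf : Set ℂ := {z | 0 < z.im}

/-- The closed upper half-plane. -/
def closedUpperHalf : Set ℂ := {z | 0 ≤ z.im}

/-- `k` is the quasi-momentum on the closed upper half-plane: the branch of
`-i log ((tr D + √(tr² D - 4)) / 2)`, that is of the solution of `2 cos k = tr D`, which is
continuous, analytic in the open half-plane, and normalised by `k(l₀) = 0`, `k(m₀) = k(m₁) = π`,
`k(l₁) = k(l₂) = 2π`, and so on, with `k` real on the spectrum and `Im k > 0` on the open upper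
half-plane. -/
structure IsQuasiMomentum (q : ℝ → ℝ) (a : ℝ) (l m : ℕ → ℝ) (k : ℂ → ℂ) : Prop where
  two_cos : ∀ z ∈ closedUpperHalf, ∀ D : Matrix (Fin 2) (Fin 2) ℂ,
    IsMonodromyMatrix q a z D → 2 * Complex.cos (k z) = D.trace
  continuousOn : ContinuousOn k closedUpperHalf
  analytic : AnalyticOnNhd ℂ k upperHalf
  at_periodic_zero : k (l 0) = 0
  at_periodic : ∀ n : ℕ, k (l (2 * n + 1)) = ((2 * n + 2 : ℝ) * Real.pi : ℝ) ∧
    k (l (2 * n + 2)) = ((2 * n + 2 : ℝ) * Real.pi : ℝ)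
  at_antiperiodic : ∀ n : ℕ, k (m (2 * n)) = ((2 * n + 1 : ℝ) * Real.pi : ℝ) ∧
    k (m (2 * n + 1)) = ((2 * n + 1 : ℝ) * Real.pi : ℝ)
  real_on_spectrum : ∀ t ∈ bandSpectrum l m, (k t).im = 0
  maps_upper : ∀ z ∈ upperHalf, 0 < (k z).im

/-- The set on which the Bloch solutions are considered: the open upper half-plane together with
the spectrum of the periodic operator without the band edges. -/
def blochDomain (l m : ℕ → ℝ) : Set ℂ :=
  upperHalf ∪ (fun t : ℝ => (t : ℂ)) '' bandInterior l m

/-- The Wronskian `W(f, g) = f' g - f g'` of two functions (with the given derivatives) at `0`. For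
two solutions of the same equation it does not depend on the point. -/
def wronskianAtZero (f f' g g' : ℝ → ℂ) : ℂ := f' 0 * g 0 - f 0 * g' 0

/-- `ψp`, `ψm` (functions of `x` and of the spectral parameter `z`, with `x`-derivatives `ψp'`,
`ψm'`) are Bloch solutions of the periodic equation, normalised in the usual way. -/
structure IsBlochPair (q : ℝ → ℝ) (a : ℝ) (l m : ℕ → ℝ) (k : ℂ → ℂ)
    (ψp ψp' ψm ψm' : ℝ → ℂ → ℂ) : Prop where
  sol_plus : ∀ z ∈ blochDomain l m,
    IsSchrodingerSolution q z (fun x => ψp x z) (fun x => ψp' x z)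
  sol_minus : ∀ z ∈ blochDomain l m,
    IsSchrodingerSolution q z (fun x => ψm x z) (fun x => ψm' x z)
  quasiperiodic_plus : ∀ z ∈ blochDomain l m, ∀ x : ℝ, 0 ≤ x →
    ψp (x + a) z = Complex.exp (Complex.I * k z) * ψp x z
  quasiperiodic_minus : ∀ z ∈ blochDomain l m, ∀ x : ℝ, 0 ≤ x →
    ψm (x + a) z = Complex.exp (-(Complex.I * k z)) * ψm x z
  analytic_plus : ∀ x : ℝ, 0 ≤ x → AnalyticOnNhd ℂ (ψp x) upperHalf
  analytic_minus : ∀ x : ℝ, 0 ≤ x → AnalyticOnNhd ℂ (ψm x) upperHalf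
  analytic_wronskian : AnalyticOnNhd ℂ (fun z => wronskianAtZero (fun x => ψp x z)
    (fun x => ψp' x z) (fun x => ψm x z) (fun x => ψm' x z)) upperHalf
  continuous_plus : ∀ x : ℝ, 0 ≤ x → ContinuousOn (ψp x) (blochDomain l m)
  continuous_minus : ∀ x : ℝ, 0 ≤ x → ContinuousOn (ψm x) (blochDomain l m)
  continuous_wronskian : ContinuousOn (fun z => wronskianAtZero (fun x => ψp x z)
    (fun x => ψp' x z) (fun x => ψm x z) (fun x => ψm' x z)) (blochDomain l m)
  conj : ∀ t ∈ bandInterior l m, ∀ x : ℝ, 0 ≤ x →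
    ψp x (t : ℂ) = (starRingEnd ℂ) (ψm x (t : ℂ))
  wronskian_ne_zero : ∀ z ∈ blochDomain l m, wronskianAtZero (fun x => ψp x z)
    (fun x => ψp' x z) (fun x => ψm x z) (fun x => ψm' x z) ≠ 0
  wronskian_on_bands : ∀ t ∈ bandInterior l m, ∃ r : ℝ, 0 < r ∧
    wronskianAtZero (fun x => ψp x (t : ℂ)) (fun x => ψp' x (t : ℂ)) (fun x => ψm x (t : ℂ))
      (fun x => ψm' x (t : ℂ)) = Complex.I * (r : ℂ)

/-- The critical points in the bands: the points of the spectrum where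
`k = π (n + 1 - {a ω / π})` or `k = π (n + {a ω / π})` for some `n ≥ 0`, with `{·}` the fractional
part. -/
def criticalPoints (a ω : ℝ) (l m : ℕ → ℝ) (k : ℂ → ℂ) : Set ℝ :=
  {t ∈ bandSpectrum l m | ∃ n : ℕ,
    k t = (Real.pi * (n + 1 - Int.fract (a * ω / Real.pi)) : ℝ) ∨
    k t = (Real.pi * (n + Int.fract (a * ω / Real.pi)) : ℝ)}

/-- The spectrum of the periodic operator without the band edges and the critical points. -/
def regularSpectrum (a ω : ℝ) (l m : ℕ → ℝ) (k : ℂ → ℂ) : Set ℝ :=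
  bandInterior l m \ criticalPoints a ω l m k

/-- `ε(z) = ½ min_{n ∈ ℤ} min (|2k(z)/a + 2ω + 2πn/a|, |2k(z)/a - 2ω + 2πn/a|)`. -/
def resonanceGap (a ω : ℝ) (k : ℂ → ℂ) (z : ℂ) : ℝ :=
  (1 / 2) * ⨅ n : ℤ,
    min ‖2 * k z / a + 2 * ω + 2 * Real.pi * n / a‖ ‖2 * k z / a - 2 * ω + 2 * Real.pi * n / a‖

/-- The set `U(β, μ)`. -/
def sectorSet (a ω : ℝ) (k : ℂ → ℂ) (β μ : ℝ) : Set ℂ :=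
  {z ∈ closedUpperHalf | resonanceGap a ω k μ ≤ 2 * resonanceGap a ω k z ∧
    0 ≤ (2 * k z / a).im ∧ (2 * k z / a).im ≤ 1 ∧
    |(k z).re - (k μ).re| ≤ β * (k z).im}

/-- The set `U(β)`, the union of the sets `U(β, μ)`. -/
def sectorUnion (a ω : ℝ) (l m : ℕ → ℝ) (k : ℂ → ℂ) (β : ℝ) : Set ℂ :=
  ⋃ μ ∈ regularSpectrum a ω l m k, sectorSet a ω k β μ

/-- The sector `|Re z - μ| ≤ M Im z` of the open upper half-plane with vertex `μ`. -/
def stolzSector (μ M : ℝ) : Set ℂ := {z | 0 < z.im ∧ |z.re - μ| ≤ M * z.im}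

/-- The periodic potential perturbed by the Wigner-von Neumann potential and by `q₁`. -/
def perturbedPotential (q q₁ : ℝ → ℝ) (c ω δ γ : ℝ) (x : ℝ) : ℝ :=
  q x + c * Real.sin (2 * ω * x + δ) / (x + 1) ^ γ + q₁ x

end

/-!
Variation of parameters writes `φ = A ψ₋ + B ψ₊`, `φ' = A ψ₋' + B ψ₊'`, where the amplitudes satisfy
`A' = -(Q / W) (ψ₊ ψ₋ A + ψ₊² B)` and `B' = (Q / W) (ψ₋² A + ψ₊ ψ₋ B)`, with `W` the Wronskian and
`Q = h θ + q₁`, `h = c / (x + 1) ^ γ`, `θ = sin (2 ω x + δ)`. The products `ψ₊ ψ₋`, `ψ₊²`, `ψ₋²` are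
quasi-periodic with multipliers `1`, `exp (± 2 i k)`. In the open upper half-plane, and at the
noncritical points of the spectrum, these multipliers times `exp (± 2 i ω a)` differ from `1`
(`multiplier_ne_one`); on the spectrum this uses `k ≥ 0` (`IsQuasiMomentum.re_nonneg`). Hence the
products times `θ` have quasi-periodic primitives of the same growth (`exists_isNonresonant_sin`).

Integrating by parts once, with these primitives, replaces `h` in the system by `h'`, `h²` and
`h q₁`, all integrable because `γ > 1 / 2`. So `A` converges, and `B` converges in the sense
weighted by `exp (-2 Im k x / a)` (`amplitude_asymptotics`). All bounds depend only on the size of the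
Bloch solutions on one period and on the distance of the multipliers from `1`, hence they are locally
uniform in the spectral parameter, up to the noncritical points of the spectrum
(`IsBlochPair.amplitude_locally_uniform`).

For each `x` the amplitudes are continuous in the spectral parameter up to the spectrum and `A` is
analytic in the half-plane. This follows from an a priori estimate for the inhomogeneous equation,
applied to differences and difference quotients of solutions (`IsFixedDataFamily.continuousOn`,
`IsFixedDataFamily.differentiableAt`); the `x`-derivatives of the Bloch solutions inherit the
regularity of the values (`deriv_regular_of_value_regular`). The locally uniform limit of `A` is
therefore analytic in the half-plane and continuous up to every noncritical point of the spectrum.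
For `Im k > 0` the term `B ψ₊` is negligible; on the spectrum `B` is the complex conjugate of `A`,
as `φ` is real there.
-/

/-! ### Absolutely continuous functions on the half-line -/

/-- `F` is absolutely continuous on every interval `[0, x]`, with density `f`: the integrated form
of `F' = f` almost everywhere on the half-line. -/
structure IsACPrimitive {E : Type*} [NormedAddCommGroup E] [NormedSpace ℝ E] (F f : ℝ → E) :
    Prop where
  intervalIntegrable_zero : ∀ x : ℝ, 0 ≤ x → IntervalIntegrable f volume 0 x
  eq_add_integral : ∀ x : ℝ, 0 ≤ x → F x = F 0 + ∫ t in (0 : ℝ)..x, f t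

namespace IsACPrimitive

variable {E : Type*} [NormedAddCommGroup E] [NormedSpace ℝ E] {F f G g : ℝ → E}

theorem intervalIntegrable (h : IsACPrimitive F f) {x y : ℝ} (hx : 0 ≤ x) (hy : 0 ≤ y) :
    IntervalIntegrable f volume x y :=
  (h.intervalIntegrable_zero x hx).symm.trans (h.intervalIntegrable_zero y hy)

theorem integral_eq_sub (h : IsACPrimitive F f) {x y : ℝ} (hx : 0 ≤ x) (hy : 0 ≤ y) :
    ∫ t in x..y, f t = F y - F x := by
  have := intervalIntegral.integral_add_adjacent_intervals (h.intervalIntegrable_zero x hx)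
    (h.intervalIntegrable hx hy)
  rw [h.eq_add_integral x hx, h.eq_add_integral y hy, ← this]
  abel

theorem continuousOn (h : IsACPrimitive F f) : ContinuousOn F (Ici 0) := by
  intro x hx
  have hx' : (0 : ℝ) ≤ x := hx
  have h1 : ContinuousOn (fun y => F 0 + ∫ t in (0 : ℝ)..y, f t) (Icc 0 (x + 1)) := by
    have := intervalIntegral.continuousOn_primitive_interval'
      (h.intervalIntegrable_zero (x + 1) (by linarith)) left_mem_uIcc
    rw [uIcc_of_le (by linarith)] at this
    exact continuousOn_const.add this
  have h2 : ContinuousOn F (Icc 0 (x + 1)) := h1.congr fun y hy => h.eq_add_integral y hy.1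
  refine (h2 x ⟨hx', by linarith⟩).mono_of_mem_nhdsWithin ?_
  rw [← Ici_inter_Iic]
  exact inter_mem_nhdsWithin _ (Iic_mem_nhds (by linarith))

theorem congr (h : IsACPrimitive F f) (hF : ∀ x, 0 ≤ x → G x = F x)
    (hf : ∀ x, 0 ≤ x → g x = f x) : IsACPrimitive G g where
  intervalIntegrable_zero x hx := by
    refine (h.intervalIntegrable_zero x hx).congr fun t ht => ?_
    rw [uIoc_of_le hx] at ht
    exact (hf t ht.1.le).symm
  eq_add_integral x hx := by
    rw [hF x hx, hF 0 le_rfl, h.eq_add_integral x hx]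
    congr 1
    refine intervalIntegral.integral_congr fun t ht => ?_
    rw [uIcc_of_le hx] at ht
    exact (hf t ht.1).symm

theorem add (hF : IsACPrimitive F f) (hG : IsACPrimitive G g) :
    IsACPrimitive (fun x => F x + G x) (fun x => f x + g x) where
  intervalIntegrable_zero x hx :=
    (hF.intervalIntegrable_zero x hx).add (hG.intervalIntegrable_zero x hx)
  eq_add_integral x hx := by
    rw [intervalIntegral.integral_add (hF.intervalIntegrable_zero x hx)
      (hG.intervalIntegrable_zero x hx), hF.eq_add_integral x hx, hG.eq_add_integral x hx]
    abel

theorem sub (hF : IsACPrimitive F f) (hG : IsACPrimitive G g) :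
    IsACPrimitive (fun x => F x - G x) (fun x => f x - g x) where
  intervalIntegrable_zero x hx :=
    (hF.intervalIntegrable_zero x hx).sub (hG.intervalIntegrable_zero x hx)
  eq_add_integral x hx := by
    rw [intervalIntegral.integral_sub (hF.intervalIntegrable_zero x hx)
      (hG.intervalIntegrable_zero x hx), hF.eq_add_integral x hx, hG.eq_add_integral x hx]
    abel

theorem map {E' : Type*} [NormedAddCommGroup E'] [NormedSpace ℝ E'] [CompleteSpace E]
    [CompleteSpace E'] (L : E →L[ℝ] E') (hF : IsACPrimitive F f) :
    IsACPrimitive (fun x => L (F x)) (fun x => L (f x)) where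
  intervalIntegrable_zero x hx := by
    have := hF.intervalIntegrable_zero x hx
    exact ⟨L.integrable_comp this.1, L.integrable_comp this.2⟩
  eq_add_integral x hx := by
    rw [L.intervalIntegral_comp_comm (hF.intervalIntegrable_zero x hx),
      hF.eq_add_integral x hx, map_add]

theorem const_mul {F f : ℝ → ℂ} (hF : IsACPrimitive F f) (e : ℂ) :
    IsACPrimitive (fun x => e * F x) (fun x => e * f x) :=
  hF.map ((ContinuousLinearMap.mul ℂ ℂ e).restrictScalars ℝ)

theorem ofReal {F f : ℝ → ℝ} (hF : IsACPrimitive F f) :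
    IsACPrimitive (fun x => (F x : ℂ)) (fun x => (f x : ℂ)) :=
  hF.map Complex.ofRealCLM

theorem of_hasDerivWithinAt [CompleteSpace E]
    (h : ∀ x : ℝ, 0 ≤ x → HasDerivWithinAt F (f x) (Ici 0) x)
    (hf : ContinuousOn f (Ici 0)) : IsACPrimitive F f := by
  have hint : ∀ x : ℝ, 0 ≤ x → IntervalIntegrable f volume 0 x := fun x hx =>
    (hf.mono (by rw [uIcc_of_le hx]; exact Icc_subset_Ici_self)).intervalIntegrable
  refine ⟨hint, fun x hx => ?_⟩
  rw [intervalIntegral.integral_eq_sub_of_hasDeriv_right_of_le hx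
    (fun y hy => ((h y hy.1).continuousWithinAt).mono Icc_subset_Ici_self)
    (fun y hy => (h y hy.1.le).mono (fun t ht => le_trans hy.1.le (le_of_lt ht))) (hint x hx)]
  abel

theorem mul_real {F f G g : ℝ → ℝ} (hF : IsACPrimitive F f) (hG : IsACPrimitive G g) :
    IsACPrimitive (fun x => F x * G x) (fun x => f x * G x + F x * g x) := by
  have hFi : ∀ x : ℝ, 0 ≤ x → IntervalIntegrable (fun t => f t * G t + F t * g t) volume 0 x := by
    intro x hx
    have hs : uIcc 0 x ⊆ Ici 0 := by rw [uIcc_of_le hx]; exact Icc_subset_Ici_self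
    exact ((hF.intervalIntegrable_zero x hx).mul_continuousOn (hG.continuousOn.mono hs)).add
      ((hG.intervalIntegrable_zero x hx).continuousOn_mul (hF.continuousOn.mono hs))
  refine ⟨hFi, fun x hx => ?_⟩
  have hfi := hF.intervalIntegrable_zero x hx
  have hgi := hG.intervalIntegrable_zero x hx
  have hF1 : AbsolutelyContinuousOnInterval (fun y => (F 0 : ℝ) + ∫ t in (0 : ℝ)..y, f t) 0 x :=
    ((contDiff_const (n := 1)).contDiffOn.absolutelyContinuousOnInterval).add
      (hfi.absolutelyContinuousOnInterval_intervalIntegral left_mem_uIcc)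
  have hG1 : AbsolutelyContinuousOnInterval (fun y => (G 0 : ℝ) + ∫ t in (0 : ℝ)..y, g t) 0 x :=
    ((contDiff_const (n := 1)).contDiffOn.absolutelyContinuousOnInterval).add
      (hgi.absolutelyContinuousOnInterval_intervalIntegral left_mem_uIcc)
  have key := AbsolutelyContinuousOnInterval.integral_deriv_mul_eq_sub hF1 hG1
  have hae : ∫ t in (0 : ℝ)..x, (f t * G t + F t * g t) =
      F x * G x - F 0 * G 0 := by
    simp only [intervalIntegral.integral_same, add_zero, ← hF.eq_add_integral x hx,
      ← hG.eq_add_integral x hx] at key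
    rw [← key]
    refine intervalIntegral.integral_congr_ae ?_
    filter_upwards [hfi.ae_hasDerivAt_integral, hgi.ae_hasDerivAt_integral] with t h1 h2 ht
    have ht' : t ∈ uIcc 0 x := uIoc_subset_uIcc ht
    have ht0 : 0 ≤ t := by rw [uIcc_of_le hx] at ht'; exact ht'.1
    rw [((h1 ht' 0 left_mem_uIcc).const_add (F 0)).deriv,
      ((h2 ht' 0 left_mem_uIcc).const_add (G 0)).deriv, ← hF.eq_add_integral t ht0,
      ← hG.eq_add_integral t ht0]
  rw [hae]
  ring

/-- The product rule, reduced to the one for real functions by separating real and imaginary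
parts. -/
theorem mul {F f G g : ℝ → ℂ} (hF : IsACPrimitive F f) (hG : IsACPrimitive G g) :
    IsACPrimitive (fun x => F x * G x) (fun x => f x * G x + F x * g x) := by
  have Fr : IsACPrimitive (fun x => (F x).re) (fun x => (f x).re) := hF.map Complex.reCLM
  have Fi : IsACPrimitive (fun x => (F x).im) (fun x => (f x).im) := hF.map Complex.imCLM
  have Gr : IsACPrimitive (fun x => (G x).re) (fun x => (g x).re) := hG.map Complex.reCLM
  have Gi : IsACPrimitive (fun x => (G x).im) (fun x => (g x).im) := hG.map Complex.imCLM
  refine (((Fr.mul_real Gr).sub (Fi.mul_real Gi)).ofReal.add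
    (((Fr.mul_real Gi).add (Fi.mul_real Gr)).ofReal.const_mul Complex.I)).congr
    (fun x _ => ?_) (fun x _ => ?_)
  · apply Complex.ext <;> simp
  · apply Complex.ext <;> simp <;> ring

theorem norm_sub_le (h : IsACPrimitive F f) {w : ℝ → ℝ} {x y : ℝ} (hx : 0 ≤ x) (hxy : x ≤ y)
    (hw : IntervalIntegrable w volume x y) (hfw : ∀ t ∈ Icc x y, ‖f t‖ ≤ w t) :
    ‖F y - F x‖ ≤ ∫ t in x..y, w t := by
  rw [← h.integral_eq_sub hx (hx.trans hxy)]
  refine (intervalIntegral.norm_integral_le_integral_norm hxy).trans ?_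
  exact intervalIntegral.integral_mono_on hxy (h.intervalIntegrable hx (hx.trans hxy)).norm hw hfw

theorem eq_zero_add_of_density_zero (h : IsACPrimitive F f) (hf : ∀ x, 0 ≤ x → f x = 0) {x : ℝ}
    (hx : 0 ≤ x) : F x = F 0 := by
  have := h.norm_sub_le (w := fun _ => 0) le_rfl hx (by simp) (fun t ht => by simp [hf t ht.1])
  simpa [sub_eq_zero] using this

end IsACPrimitive

/-! ### Gronwall's inequality with an integrable weight -/

/-- `W ^ n / n!` is the `n`-fold iterated integral of the density of `W`. -/
theorem IsACPrimitive.pow_div_factorial {W w : ℝ → ℝ} (hW : IsACPrimitive W w) (n : ℕ) :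
    IsACPrimitive (fun x => W x ^ (n + 1) / (n + 1).factorial)
      (fun x => w x * (W x ^ n / n.factorial)) := by
  have hpow : ∀ n : ℕ, IsACPrimitive (fun x => W x ^ (n + 1))
      (fun x => (n + 1) * (w x * W x ^ n)) := by
    intro n
    induction n with
    | zero => simpa using hW
    | succ n ih =>
      refine (ih.mul_real hW).congr (fun x _ => by ring) (fun x _ => ?_)
      push_cast
      ring
  have h := (hpow n).map ((ContinuousLinearMap.mul ℝ ℝ) (((n + 1).factorial : ℝ)⁻¹))
  refine h.congr (fun x _ => ?_) (fun x _ => ?_)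
  · simp only [ContinuousLinearMap.mul_apply']
    rw [div_eq_inv_mul]
  · simp only [ContinuousLinearMap.mul_apply', Nat.factorial_succ, Nat.cast_mul, Nat.cast_succ]
    have : (n.factorial : ℝ) ≠ 0 := by positivity
    field_simp

/-- Gronwall's inequality in integrated form, for a weight that is only integrable. Iterating the
hypothesis `n` times bounds `u` by the `n`-th partial sum of the exponential series, up to a
remainder `M W ^ n / n!`. -/
theorem le_mul_exp_of_le_add_integral {X K : ℝ} {u w : ℝ → ℝ} (hK : 0 ≤ K)
    (hu : ContinuousOn u (Icc 0 X)) (hw : ∀ x, 0 ≤ x → IntervalIntegrable w volume 0 x)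
    (hw0 : ∀ x, 0 ≤ x → 0 ≤ w x)
    (h : ∀ x ∈ Icc 0 X, u x ≤ K + ∫ t in (0 : ℝ)..x, w t * u t) :
    ∀ x ∈ Icc 0 X, u x ≤ K * Real.exp (∫ t in (0 : ℝ)..x, w t) := by
  intro x hx
  have hX : 0 ≤ X := hx.1.trans hx.2
  set W : ℝ → ℝ := fun x => ∫ t in (0 : ℝ)..x, w t with hWdef
  have hW : IsACPrimitive W w := ⟨hw, fun x _ => by simp [hWdef]⟩
  have hW0 : ∀ x, 0 ≤ x → 0 ≤ W x := fun x hx =>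
    intervalIntegral.integral_nonneg hx fun t ht => hw0 t ht.1
  obtain ⟨M, hM⟩ := isCompact_Icc.bddAbove_image hu
  have hM' : ∀ y ∈ Icc 0 X, u y ≤ M := fun y hy => hM (mem_image_of_mem u hy)
  have key : ∀ n : ℕ, ∀ y ∈ Icc 0 X, u y ≤
      K * ∑ j ∈ Finset.range n, W y ^ j / j.factorial + M * (W y ^ n / n.factorial) := by
    intro n
    induction n with
    | zero => intro y hy; simpa using hM' y hy
    | succ n ih =>
      intro y hy
      have hint1 : ∀ j : ℕ, IntervalIntegrable (fun t => w t * (W t ^ j / j.factorial)) volume 0 y :=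
        fun j => (hW.pow_div_factorial j).intervalIntegrable_zero y hy.1
      have hval : ∀ j : ℕ, ∫ t in (0 : ℝ)..y, w t * (W t ^ j / j.factorial) =
          W y ^ (j + 1) / (j + 1).factorial := by
        intro j
        rw [(hW.pow_div_factorial j).integral_eq_sub le_rfl hy.1]
        simp [hWdef]
      have hsum : IntervalIntegrable
          (fun t => ∑ j ∈ Finset.range n, w t * (W t ^ j / j.factorial)) volume 0 y := by
        have := IntervalIntegrable.sum (μ := volume) (a := 0) (b := y) (Finset.range n)
          (f := fun j t => w t * (W t ^ j / j.factorial)) (fun j _ => hint1 j)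
        refine this.congr fun t _ => ?_
        simp
      have hle : ∫ t in (0 : ℝ)..y, w t * u t ≤
          ∫ t in (0 : ℝ)..y, (K * ∑ j ∈ Finset.range n, w t * (W t ^ j / j.factorial) +
            M * (w t * (W t ^ n / n.factorial))) := by
        refine intervalIntegral.integral_mono_on hy.1 ?_ ?_ ?_
        · refine (hw y hy.1).mul_continuousOn (hu.mono ?_)
          rw [uIcc_of_le hy.1]
          exact Icc_subset_Icc_right hy.2
        · exact (hsum.const_mul K).add ((hint1 n).const_mul M)
        · intro t ht
          have := mul_le_mul_of_nonneg_left (ih t ⟨ht.1, ht.2.trans hy.2⟩) (hw0 t ht.1)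
          refine this.trans (le_of_eq ?_)
          rw [← Finset.mul_sum]
          ring
      refine (h y hy).trans ((add_le_add_right hle K).trans (le_of_eq ?_))
      rw [intervalIntegral.integral_add (hsum.const_mul K) ((hint1 n).const_mul M),
        intervalIntegral.integral_const_mul, intervalIntegral.integral_const_mul,
        intervalIntegral.integral_finsetSum (fun j _ => hint1 j), hval n,
        Finset.sum_congr rfl (fun j _ => hval j), Finset.sum_range_succ']
      simp
      ring
  have hlim : Tendsto (fun n : ℕ => K * Real.exp (W x) + M * (W x ^ n / n.factorial)) atTop
      (𝓝 (K * Real.exp (W x) + M * 0)) :=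
    ((FloorSemiring.tendsto_pow_div_factorial_atTop (W x)).const_mul M).const_add _
  rw [mul_zero, add_zero] at hlim
  refine ge_of_tendsto hlim (Eventually.of_forall fun n => (key n x hx).trans ?_)
  gcongr
  exact Real.sum_le_exp_of_nonneg (hW0 x hx.1) n

/-! ### Solutions of the Schrödinger equation and their dependence on the spectral parameter -/

namespace IsSchrodingerSolution

variable {V : ℝ → ℝ} {z : ℂ} {f f' g g' : ℝ → ℂ}

theorem isACPrimitive (h : IsSchrodingerSolution V z f f')
    (hV : ∀ x, 0 ≤ x → IntervalIntegrable V volume 0 x) :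
    IsACPrimitive f f' ∧ IsACPrimitive f' (fun x => ((V x : ℂ) - z) * f x) := by
  have hf : ContinuousOn f (Ici 0) := fun x hx => (h.1 x hx).continuousWithinAt
  have h' : IsACPrimitive f' (fun x => ((V x : ℂ) - z) * f x) := by
    refine ⟨fun x hx => ?_, h.2⟩
    refine IntervalIntegrable.mul_continuousOn ?_ (hf.mono ?_)
    · exact IntervalIntegrable.sub ⟨(hV x hx).1.ofReal, (hV x hx).2.ofReal⟩ (by simp)
    · rw [uIcc_of_le hx]; exact Icc_subset_Ici_self
  exact ⟨IsACPrimitive.of_hasDerivWithinAt h.1 h'.continuousOn, h'⟩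

theorem of_isACPrimitive (h : ∀ x : ℝ, 0 ≤ x → HasDerivWithinAt f (f' x) (Ici 0) x)
    (h' : IsACPrimitive f' (fun x => ((V x : ℂ) - z) * f x)) : IsSchrodingerSolution V z f f' :=
  ⟨h, h'.eq_add_integral⟩

theorem linear_combination (hf : IsSchrodingerSolution V z f f')
    (hg : IsSchrodingerSolution V z g g') (hV : ∀ x, 0 ≤ x → IntervalIntegrable V volume 0 x)
    (s t : ℂ) :
    IsSchrodingerSolution V z (fun x => s * f x + t * g x) (fun x => s * f' x + t * g' x) := by
  refine of_isACPrimitive (fun x hx => ((hf.1 x hx).const_mul s).add ((hg.1 x hx).const_mul t)) ?_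
  refine (((hf.isACPrimitive hV).2.const_mul s).add ((hg.isACPrimitive hV).2.const_mul t)).congr
    (fun _ _ => rfl) (fun x _ => by ring)

end IsSchrodingerSolution

/-- The growth factor on `[0, X]` of solutions with spectral parameter of modulus at most `R`. -/
noncomputable def growthFactor (V : ℝ → ℝ) (R X : ℝ) : ℝ :=
  Real.exp (∫ t in (0 : ℝ)..X, (1 + |V t| + R))

theorem growthFactor_pos (V : ℝ → ℝ) (R X : ℝ) : 0 < growthFactor V R X := Real.exp_pos _

/-- The a priori estimate for the inhomogeneous equation `f'' = (V - z) f - g`. -/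
theorem norm_add_norm_le_growthFactor {V : ℝ → ℝ} {z : ℂ} {f f' g : ℝ → ℂ} {R X M : ℝ}
    (hV : ∀ x, 0 ≤ x → IntervalIntegrable V volume 0 x) (hz : ‖z‖ ≤ R)
    (hf : IsACPrimitive f f') (hf' : IsACPrimitive f' (fun x => ((V x : ℂ) - z) * f x - g x))
    (hX : 0 ≤ X) (hM : ∀ t ∈ Icc 0 X, ‖g t‖ ≤ M) :
    ∀ x ∈ Icc 0 X, ‖f x‖ + ‖f' x‖ ≤ (‖f 0‖ + ‖f' 0‖ + X * M) * growthFactor V R X := by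
  have hR : 0 ≤ R := (norm_nonneg z).trans hz
  have hM0 : 0 ≤ M := (norm_nonneg _).trans (hM 0 ⟨le_rfl, hX⟩)
  set w : ℝ → ℝ := fun t => 1 + |V t| + R with hwdef
  have hw0 : ∀ t, 0 ≤ t → 0 ≤ w t := fun t _ => by simp only [hwdef]; positivity
  have hw : ∀ x, 0 ≤ x → IntervalIntegrable w volume 0 x := fun x hx =>
    ((by simp : IntervalIntegrable (fun _ : ℝ => (1 : ℝ)) volume 0 x).add (hV x hx).abs).add
      (by simp)
  have hNc : ContinuousOn (fun x => ‖f x‖ + ‖f' x‖) (Ici 0) :=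
    hf.continuousOn.norm.add hf'.continuousOn.norm
  have key := le_mul_exp_of_le_add_integral (X := X) (K := ‖f 0‖ + ‖f' 0‖ + X * M)
    (u := fun x => ‖f x‖ + ‖f' x‖) (w := w) (by positivity) (hNc.mono Icc_subset_Ici_self) hw hw0 ?_
  · intro x hx
    refine (key x hx).trans ?_
    refine mul_le_mul_of_nonneg_left ?_ (by positivity)
    refine Real.exp_le_exp.2 ?_
    exact intervalIntegral.integral_mono_interval le_rfl hx.1 hx.2
      ((ae_restrict_iff' measurableSet_Ioc).2 (Eventually.of_forall fun t ht => hw0 t ht.1.le))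
      (hw X hX)
  · intro x hx
    have hsub : uIcc 0 x ⊆ Ici 0 := by rw [uIcc_of_le hx.1]; exact Icc_subset_Ici_self
    have hi1 : IntervalIntegrable (fun t => ‖f' t‖) volume 0 x :=
      (hf'.continuousOn.norm.mono hsub).intervalIntegrable
    have hi2 : IntervalIntegrable (fun t => (|V t| + R) * ‖f t‖ + M) volume 0 x := by
      refine IntervalIntegrable.add (IntervalIntegrable.mul_continuousOn ?_
        (hf.continuousOn.norm.mono hsub)) (by simp)
      exact (hV x hx.1).abs.add (by simp)
    have e1 : ‖f x - f 0‖ ≤ ∫ t in (0 : ℝ)..x, ‖f' t‖ :=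
      hf.norm_sub_le le_rfl hx.1 hi1 fun t _ => le_rfl
    have e2 : ‖f' x - f' 0‖ ≤ ∫ t in (0 : ℝ)..x, ((|V t| + R) * ‖f t‖ + M) := by
      refine hf'.norm_sub_le le_rfl hx.1 hi2 fun t ht => ?_
      refine (_root_.norm_sub_le _ _).trans (add_le_add ?_ (hM t ⟨ht.1, ht.2.trans hx.2⟩))
      rw [norm_mul]
      refine mul_le_mul_of_nonneg_right ((_root_.norm_sub_le _ _).trans ?_) (norm_nonneg _)
      rw [Complex.norm_real, Real.norm_eq_abs]
      exact add_le_add le_rfl hz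
    have e3 : ∫ t in (0 : ℝ)..x, ‖f' t‖ + ((|V t| + R) * ‖f t‖ + M) ≤
        ∫ t in (0 : ℝ)..x, (w t * (‖f t‖ + ‖f' t‖) + M) := by
      refine intervalIntegral.integral_mono_on hx.1 (hi1.add hi2) ?_ ?_
      · exact ((hw x hx.1).mul_continuousOn (hNc.mono hsub)).add (by simp)
      · intro t ht
        have h1 : 0 ≤ (|V t| + R) * ‖f' t‖ := by positivity
        have h2 := norm_nonneg (f t)
        simp only [hwdef]
        nlinarith
    rw [intervalIntegral.integral_add hi1 hi2, intervalIntegral.integral_add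
      ((hw x hx.1).mul_continuousOn (hNc.mono hsub)) (by simp), intervalIntegral.integral_const,
      smul_eq_mul, sub_zero] at e3
    have h1 := norm_le_norm_add_norm_sub' (f x) (f 0)
    have h2 := norm_le_norm_add_norm_sub' (f' x) (f' 0)
    have h3 : x * M ≤ X * M := mul_le_mul_of_nonneg_right hx.2 hM0
    linarith

/-- A function whose difference quotients at a point are Lipschitz is differentiable there. -/
theorem differentiableAt_of_slope_lipschitz {f : ℂ → ℂ} {z : ℂ} {U : Set ℂ} {C : ℝ}
    (hU : U ∈ 𝓝 z) (h : ∀ w ∈ U, ∀ v ∈ U, w ≠ z → v ≠ z →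
      ‖slope f z w - slope f z v‖ ≤ C * ‖w - v‖) : DifferentiableAt ℂ f z := by
  have hc : Cauchy (Filter.map (slope f z) (𝓝[≠] z)) := by
    refine Metric.cauchy_iff.2 ⟨inferInstance, fun ε hε => ?_⟩
    have hr : 0 < ε / (2 * (|C| + 1)) := by positivity
    refine ⟨slope f z '' (U ∩ Metric.ball z (ε / (2 * (|C| + 1))) ∩ {z}ᶜ), ?_, ?_⟩
    · refine image_mem_map (inter_mem (mem_nhdsWithin_of_mem_nhds
        (inter_mem hU (Metric.ball_mem_nhds _ hr))) self_mem_nhdsWithin)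
    · rintro _ ⟨w, ⟨⟨hwU, hwb⟩, hwz⟩, rfl⟩ _ ⟨v, ⟨⟨hvU, hvb⟩, hvz⟩, rfl⟩
      rw [dist_eq_norm]
      refine (h w hwU v hvU hwz hvz).trans_lt ?_
      have hd : ‖w - v‖ < ε / (|C| + 1) := by
        rw [← dist_eq_norm]
        have h1 := dist_triangle_right w v z
        rw [Metric.mem_ball] at hwb hvb
        have : ε / (|C| + 1) = ε / (2 * (|C| + 1)) + ε / (2 * (|C| + 1)) := by
          field_simp
          norm_num
        linarith
      have hC : C * ‖w - v‖ ≤ (|C| + 1) * ‖w - v‖ :=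
        mul_le_mul_of_nonneg_right ((le_abs_self C).trans (by linarith)) (norm_nonneg _)
      have hlt : (|C| + 1) * ‖w - v‖ < ε := by
        rw [lt_div_iff₀ (by positivity)] at hd
        linarith
      linarith
  obtain ⟨d, hd⟩ := cauchy_map_iff_exists_tendsto.1 hc
  exact (hasDerivAt_iff_tendsto_slope.2 hd).differentiableAt

/-- `f z`, for `z ∈ Ω`, are solutions of `-y'' + V y = z y` whose Cauchy data at `0` do not depend
on `z`. -/
structure IsFixedDataFamily (V : ℝ → ℝ) (Ω : Set ℂ) (p p' : ℂ) (f f' : ℝ → ℂ → ℂ) : Prop where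
  sol : ∀ z ∈ Ω, IsSchrodingerSolution V z (fun x => f x z) (fun x => f' x z)
  value_zero : ∀ z ∈ Ω, f 0 z = p
  deriv_zero : ∀ z ∈ Ω, f' 0 z = p'

namespace IsFixedDataFamily

variable {V : ℝ → ℝ} {Ω : Set ℂ} {p p' : ℂ} {f f' : ℝ → ℂ → ℂ}

theorem norm_le (h : IsFixedDataFamily V Ω p p' f f')
    (hV : ∀ x, 0 ≤ x → IntervalIntegrable V volume 0 x) {R X : ℝ} (hX : 0 ≤ X) {z : ℂ}
    (hz : z ∈ Ω) (hzR : ‖z‖ ≤ R) :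
    ∀ x ∈ Icc 0 X, ‖f x z‖ + ‖f' x z‖ ≤ (‖p‖ + ‖p'‖) * growthFactor V R X := by
  have hs := (h.sol z hz).isACPrimitive hV
  have := norm_add_norm_le_growthFactor (g := fun _ => 0) (M := 0) hV hzR hs.1
    (hs.2.congr (fun _ _ => rfl) (fun x _ => by ring)) hX (by simp)
  simpa [h.value_zero z hz, h.deriv_zero z hz] using this

theorem lipschitz (h : IsFixedDataFamily V Ω p p' f f')
    (hV : ∀ x, 0 ≤ x → IntervalIntegrable V volume 0 x) (R : ℝ) {X : ℝ} (hX : 0 ≤ X) :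
    ∃ C : ℝ, 0 ≤ C ∧ ∀ z ∈ Ω, ∀ w ∈ Ω, ‖z‖ ≤ R → ‖w‖ ≤ R → ∀ x ∈ Icc 0 X,
      ‖f x z - f x w‖ + ‖f' x z - f' x w‖ ≤ C * ‖z - w‖ := by
  have hg := (growthFactor_pos V R X).le
  refine ⟨X * ((‖p‖ + ‖p'‖) * growthFactor V R X) * growthFactor V R X, by positivity, ?_⟩
  intro z hz w hw hzR hwR x hx
  have h1 := (h.sol z hz).isACPrimitive hV
  have h2 := (h.sol w hw).isACPrimitive hV
  have := norm_add_norm_le_growthFactor (g := fun t => (z - w) * f t w)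
    (M := ‖z - w‖ * ((‖p‖ + ‖p'‖) * growthFactor V R X)) hV hzR (h1.1.sub h2.1)
    ((h1.2.sub h2.2).congr (fun _ _ => rfl) (fun x _ => by ring)) hX ?_ x hx
  · refine this.trans (le_of_eq ?_)
    simp only [h.value_zero z hz, h.deriv_zero z hz, h.value_zero w hw, h.deriv_zero w hw,
      sub_self, norm_zero]
    ring
  · intro t ht
    rw [norm_mul]
    refine mul_le_mul_of_nonneg_left ?_ (norm_nonneg _)
    have := h.norm_le hV hX hw hwR t ht
    have h0 := norm_nonneg (f' t w)
    linarith

/-- The difference quotients in the spectral parameter solve the inhomogeneous equation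
`y'' = (V - z) y - f w` with zero data, and the a priori estimate makes them Lipschitz. -/
theorem slope_lipschitz (h : IsFixedDataFamily V Ω p p' f f')
    (hV : ∀ x, 0 ≤ x → IntervalIntegrable V volume 0 x) (R : ℝ) {X : ℝ} (hX : 0 ≤ X) :
    ∃ C : ℝ, ∀ z ∈ Ω, ∀ w ∈ Ω, ∀ v ∈ Ω, ‖z‖ ≤ R → ‖w‖ ≤ R → ‖v‖ ≤ R → w ≠ z → v ≠ z →
      ∀ x ∈ Icc 0 X, ‖slope (f x) z w - slope (f x) z v‖ +
        ‖slope (f' x) z w - slope (f' x) z v‖ ≤ C * ‖w - v‖ := by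
  obtain ⟨C, hC0, hC⟩ := h.lipschitz hV R hX
  refine ⟨X * C * growthFactor V R X, ?_⟩
  intro z hz w hw v hv hzR hwR hvR hwz hvz x hx
  have hwz' := sub_ne_zero.2 hwz
  have hvz' := sub_ne_zero.2 hvz
  have h1 := (h.sol z hz).isACPrimitive hV
  have h2 := (h.sol w hw).isACPrimitive hV
  have h3 := (h.sol v hv).isACPrimitive hV
  have hs : ∀ (F : ℝ → ℂ → ℂ) (t : ℝ), slope (F t) z w - slope (F t) z v =
      (w - z)⁻¹ * (F t w - F t z) - (v - z)⁻¹ * (F t v - F t z) := by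
    intro F t
    simp [slope_def_field, div_eq_inv_mul]
  have := norm_add_norm_le_growthFactor (g := fun t => f t w - f t v)
    (f := fun t => slope (f t) z w - slope (f t) z v)
    (f' := fun t => slope (f' t) z w - slope (f' t) z v)
    (M := C * ‖w - v‖) hV hzR
    ((((h2.1.sub h1.1).const_mul (w - z)⁻¹).sub ((h3.1.sub h1.1).const_mul (v - z)⁻¹)).congr
      (fun t _ => hs f t) (fun t _ => hs f' t))
    ((((h2.2.sub h1.2).const_mul (w - z)⁻¹).sub ((h3.2.sub h1.2).const_mul (v - z)⁻¹)).congr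
      (fun t _ => hs f' t) (fun t _ => by
        simp only [hs f t]
        field_simp
        ring)) hX ?_ x hx
  · refine this.trans (le_of_eq ?_)
    simp only [slope_def_field, h.value_zero z hz, h.deriv_zero z hz, h.value_zero w hw,
      h.deriv_zero w hw, h.value_zero v hv, h.deriv_zero v hv, sub_self, norm_zero, zero_div]
    ring
  · intro t ht
    have := hC w hw v hv hwR hvR t ht
    have h0 := norm_nonneg (f' t w - f' t v)
    linarith

theorem continuousOn (h : IsFixedDataFamily V Ω p p' f f')
    (hV : ∀ x, 0 ≤ x → IntervalIntegrable V volume 0 x) {x : ℝ} (hx : 0 ≤ x) :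
    ContinuousOn (f x) Ω ∧ ContinuousOn (f' x) Ω := by
  have aux : ∀ z ∈ Ω, ContinuousWithinAt (f x) Ω z ∧ ContinuousWithinAt (f' x) Ω z := by
    intro z hz
    obtain ⟨C, hC0, hC⟩ := h.lipschitz hV (‖z‖ + 1) hx
    have hev : ∀ᶠ w in 𝓝[Ω] z, ‖f x w - f x z‖ + ‖f' x w - f' x z‖ ≤ C * ‖w - z‖ := by
      filter_upwards [self_mem_nhdsWithin,
        mem_nhdsWithin_of_mem_nhds (Metric.ball_mem_nhds z one_pos)] with w hw hwb
      refine hC w hw z hz ?_ (by linarith) x ⟨hx, le_rfl⟩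
      rw [Metric.mem_ball, dist_eq_norm] at hwb
      have := norm_le_norm_add_norm_sub' w z
      linarith
    have hlim : Tendsto (fun w => C * ‖w - z‖) (𝓝[Ω] z) (𝓝 0) := by
      have : Tendsto (fun w => C * ‖w - z‖) (𝓝 z) (𝓝 (C * ‖z - z‖)) := by
        apply Continuous.tendsto
        fun_prop
      simpa using this.mono_left nhdsWithin_le_nhds
    refine ⟨?_, ?_⟩ <;> refine tendsto_iff_norm_sub_tendsto_zero.2
      (squeeze_zero' (Eventually.of_forall fun _ => norm_nonneg _) ?_ hlim)
    · filter_upwards [hev] with w hw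
      linarith [norm_nonneg (f' x w - f' x z)]
    · filter_upwards [hev] with w hw
      linarith [norm_nonneg (f x w - f x z)]
  exact ⟨fun z hz => (aux z hz).1, fun z hz => (aux z hz).2⟩

theorem differentiableAt (h : IsFixedDataFamily V Ω p p' f f')
    (hV : ∀ x, 0 ≤ x → IntervalIntegrable V volume 0 x) {x : ℝ} (hx : 0 ≤ x) {z : ℂ}
    (hz : Ω ∈ 𝓝 z) : DifferentiableAt ℂ (f x) z ∧ DifferentiableAt ℂ (f' x) z := by
  obtain ⟨C, hC⟩ := h.slope_lipschitz hV (‖z‖ + 1) hx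
  have hn : ∀ w ∈ Metric.ball z 1, ‖w‖ ≤ ‖z‖ + 1 := by
    intro w hwb
    rw [Metric.mem_ball, dist_eq_norm] at hwb
    have := norm_le_norm_add_norm_sub' w z
    linarith
  have hU : Ω ∩ Metric.ball z 1 ∈ 𝓝 z := inter_mem hz (Metric.ball_mem_nhds z one_pos)
  have key := fun w (hw : w ∈ Ω ∩ Metric.ball z 1) v (hv : v ∈ Ω ∩ Metric.ball z 1) hwz hvz =>
    hC z (mem_of_mem_nhds hz) w hw.1 v hv.1 (by linarith) (hn w hw.2) (hn v hv.2) hwz hvz x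
      ⟨hx, le_rfl⟩
  constructor
  · refine differentiableAt_of_slope_lipschitz (C := C) hU fun w hw v hv hwz hvz => ?_
    exact (le_add_of_nonneg_right (norm_nonneg _)).trans (key w hw v hv hwz hvz)
  · refine differentiableAt_of_slope_lipschitz (C := C) hU fun w hw v hv hwz hvz => ?_
    exact (le_add_of_nonneg_left (norm_nonneg _)).trans (key w hw v hv hwz hvz)

end IsFixedDataFamily

/-- Uniqueness for the Cauchy problem. -/
theorem IsSchrodingerSolution.eq_of_eq_zero {V : ℝ → ℝ} {z : ℂ} {f f' g g' : ℝ → ℂ}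
    (hf : IsSchrodingerSolution V z f f') (hg : IsSchrodingerSolution V z g g')
    (hV : ∀ x, 0 ≤ x → IntervalIntegrable V volume 0 x) (h0 : f 0 = g 0) (h0' : f' 0 = g' 0)
    {x : ℝ} (hx : 0 ≤ x) : f x = g x ∧ f' x = g' x := by
  have h1 := hf.isACPrimitive hV
  have h2 := hg.isACPrimitive hV
  have := norm_add_norm_le_growthFactor (g := fun _ => 0) (M := 0) (X := x) hV (le_refl ‖z‖)
    (h1.1.sub h2.1) ((h1.2.sub h2.2).congr (fun _ _ => rfl) (fun x _ => by ring)) hx (by simp) x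
    ⟨hx, le_rfl⟩
  simp only [h0, h0', sub_self, norm_zero, mul_zero, add_zero, zero_mul] at this
  have e1 := norm_nonneg (f x - g x)
  have e2 := norm_nonneg (f' x - g' x)
  exact ⟨sub_eq_zero.1 (norm_le_zero_iff.1 (by linarith)),
    sub_eq_zero.1 (norm_le_zero_iff.1 (by linarith))⟩

/-- Let `y`, `y'` be solutions which are continuous (differentiable) in the spectral parameter as
far as the values are concerned. Then so are their derivatives. The Cauchy data `y' 0` are
recovered from the values at `0` and at a point where the solution `s` with `s 0 = 0`, `s' 0 = 1`
does not vanish. -/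
theorem deriv_regular_of_value_regular {V : ℝ → ℝ} {Ω : Set ℂ} {c c' s s' y y' : ℝ → ℂ → ℂ}
    (hV : ∀ x, 0 ≤ x → IntervalIntegrable V volume 0 x)
    (hc : IsFixedDataFamily V Ω 1 0 c c') (hs : IsFixedDataFamily V Ω 0 1 s s')
    (hy : ∀ z ∈ Ω, IsSchrodingerSolution V z (fun x => y x z) (fun x => y' x z))
    {x : ℝ} (hx : 0 ≤ x) {z : ℂ} (hz : z ∈ Ω) :
    ((∀ t, 0 ≤ t → ContinuousWithinAt (y t) Ω z) → ContinuousWithinAt (y' x) Ω z) ∧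
    ((∀ t, 0 ≤ t → DifferentiableAt ℂ (y t) z) → Ω ∈ 𝓝 z → DifferentiableAt ℂ (y' x) z) := by
  have hrep : ∀ w ∈ Ω, ∀ t, 0 ≤ t → y t w = y 0 w * c t w + y' 0 w * s t w ∧
      y' t w = y 0 w * c' t w + y' 0 w * s' t w := by
    intro w hw t ht
    refine (hy w hw).eq_of_eq_zero
      ((hc.sol w hw).linear_combination (hs.sol w hw) hV (y 0 w) (y' 0 w)) hV ?_ ?_ ht
    · simp [hc.value_zero w hw, hs.value_zero w hw]
    · simp [hc.deriv_zero w hw, hs.deriv_zero w hw]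
  -- `s` vanishes at `0` with derivative `1`, hence nowhere else near `0`.
  obtain ⟨x₁, hx₁, hsx⟩ : ∃ x₁ : ℝ, 0 ≤ x₁ ∧ s x₁ z ≠ 0 := by
    by_contra! hcon
    have h1 := (hs.sol z hz).1 0 le_rfl
    have h2 : HasDerivWithinAt (fun x => s x z) 0 (Ici 0) 0 :=
      (hasDerivWithinAt_const (0 : ℝ) (Ici 0) (0 : ℂ)).congr (fun t ht => hcon t ht)
        (hcon 0 le_rfl)
    have := (uniqueDiffWithinAt_Ici (0 : ℝ)).eq_deriv _ h1 h2
    simp [hs.deriv_zero z hz] at this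
  have hy0 : ∀ w ∈ Ω, s x₁ w ≠ 0 → y' 0 w = (y x₁ w - y 0 w * c x₁ w) / s x₁ w := by
    intro w hw hne
    rw [eq_div_iff hne, (hrep w hw x₁ hx₁).1]
    ring
  have hsne : ∀ᶠ w in 𝓝[Ω] z, s x₁ w ≠ 0 :=
    ((hs.continuousOn hV hx₁).1 z hz).eventually_ne hsx
  have hEq : ∀ᶠ w in 𝓝[Ω] z,
      y' x w = y 0 w * c' x w + (y x₁ w - y 0 w * c x₁ w) / s x₁ w * s' x w := by
    filter_upwards [hsne, self_mem_nhdsWithin] with w hne hw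
    rw [(hrep w hw x hx).2, hy0 w hw hne]
  refine ⟨fun hcont => ?_, fun hdiff hΩ => ?_⟩
  · refine ContinuousWithinAt.congr_of_eventuallyEq ?_ hEq (hEq.self_of_nhdsWithin hz)
    exact ((hcont 0 le_rfl).mul ((hc.continuousOn hV hx).2 z hz)).add
      ((((hcont x₁ hx₁).sub ((hcont 0 le_rfl).mul ((hc.continuousOn hV hx₁).1 z hz))).div
        ((hs.continuousOn hV hx₁).1 z hz) hsx).mul ((hs.continuousOn hV hx).2 z hz))
  · rw [nhdsWithin_eq_nhds.2 hΩ] at hEq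
    refine DifferentiableAt.congr_of_eventuallyEq ?_ hEq
    exact ((hdiff 0 le_rfl).mul (hc.differentiableAt hV hx hΩ).2).add
      ((((hdiff x₁ hx₁).sub ((hdiff 0 le_rfl).mul (hc.differentiableAt hV hx₁ hΩ).1)).div
        (hs.differentiableAt hV hx₁ hΩ).1 hsx).mul (hs.differentiableAt hV hx hΩ).2)

/-! ### Quasi-periodic functions and their primitives -/

/-- A function on the half-line which is multiplied by `ρ` under the shift by `a` grows like
`exp (κ x)`, where `|ρ| = exp (κ a)`. -/
theorem norm_le_of_quasiperiodic {a κ K : ℝ} (ha : 0 < a) {ρ : ℂ} {f : ℝ → ℂ}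
    (hf : ∀ x, 0 ≤ x → f (x + a) = ρ * f x) (hρ : ‖ρ‖ = Real.exp (κ * a))
    (hK : ∀ x ∈ Icc 0 a, ‖f x‖ ≤ K) {x : ℝ} (hx : 0 ≤ x) :
    ‖f x‖ ≤ K * Real.exp (|κ| * a) * Real.exp (κ * x) := by
  have hK0 : 0 ≤ K := (norm_nonneg _).trans (hK 0 ⟨le_rfl, ha.le⟩)
  have hn : ∀ (n : ℕ) (y : ℝ), 0 ≤ y → f (y + n * a) = ρ ^ n * f y := by
    intro n
    induction n with
    | zero => intro y _; simp
    | succ n ih =>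
      intro y hy
      have : y + (n + 1 : ℕ) * a = (y + n * a) + a := by push_cast; ring
      rw [this, hf _ (by positivity), ih y hy]
      ring
  set n := ⌊x / a⌋₊
  have h1 : (n : ℝ) * a ≤ x := by
    have := Nat.floor_le (div_nonneg hx ha.le)
    rwa [le_div_iff₀ ha] at this
  have h2 : x < (n + 1) * a := by
    have := Nat.lt_floor_add_one (x / a)
    rwa [div_lt_iff₀ ha] at this
  have hy : x - n * a ∈ Icc 0 a := ⟨by linarith, by linarith⟩
  have h3 := hn n (x - n * a) hy.1
  rw [sub_add_cancel] at h3
  rw [h3, norm_mul, norm_pow, hρ, ← Real.exp_nat_mul]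
  have h4 : Real.exp (n * (κ * a)) ≤ Real.exp (|κ| * a) * Real.exp (κ * x) := by
    rw [← Real.exp_add, Real.exp_le_exp]
    have h5 : -κ * (x - n * a) ≤ |κ| * a :=
      mul_le_mul (neg_le_abs κ) hy.2 hy.1 (abs_nonneg κ)
    nlinarith
  calc Real.exp (n * (κ * a)) * ‖f (x - n * a)‖
      ≤ (Real.exp (|κ| * a) * Real.exp (κ * x)) * K :=
        mul_le_mul h4 (hK _ hy) (norm_nonneg _) (by positivity)
    _ = _ := by ring

/-- If the multiplier `ρ` of a quasi-periodic function is not `1`, then the function has a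
quasi-periodic primitive with the same multiplier, and so the primitive has the same growth. -/
theorem exists_primitive_of_quasiperiodic {a κ K d : ℝ} (ha : 0 < a) {ρ : ℂ} {g : ℝ → ℂ}
    (hgc : ContinuousOn g (Ici 0)) (hg : ∀ x, 0 ≤ x → g (x + a) = ρ * g x)
    (hρ : ‖ρ‖ = Real.exp (κ * a)) (hK : ∀ x ∈ Icc 0 a, ‖g x‖ ≤ K) (hd : 0 < d)
    (hdρ : d ≤ ‖ρ - 1‖) :
    ∃ G : ℝ → ℂ, IsACPrimitive G g ∧ ∀ x, 0 ≤ x →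
      ‖G x‖ ≤ K * a * (1 + 1 / d) * Real.exp (|κ| * a) * Real.exp (κ * x) := by
  have hK0 : 0 ≤ K := (norm_nonneg _).trans (hK 0 ⟨le_rfl, ha.le⟩)
  have hρ1 : ρ - 1 ≠ 0 := norm_pos_iff.1 (hd.trans_le hdρ)
  have hint : ∀ x y : ℝ, 0 ≤ x → 0 ≤ y → IntervalIntegrable g volume x y := fun x y hx hy =>
    (hgc.mono fun t ht => (le_min hx hy).trans ht.1).intervalIntegrable
  set I : ℂ := ∫ t in (0 : ℝ)..a, g t with hI
  set G : ℝ → ℂ := fun x => (∫ t in (0 : ℝ)..x, g t) + (ρ - 1)⁻¹ * I with hG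
  have hGp : IsACPrimitive G g := by
    refine ⟨fun x hx => hint 0 x le_rfl hx, fun x _ => ?_⟩
    simp [hG]
    ring
  have hGq : ∀ x, 0 ≤ x → G (x + a) = ρ * G x := by
    intro x hx
    have h1 := intervalIntegral.integral_add_adjacent_intervals (hint 0 a le_rfl ha.le)
      (hint a (x + a) ha.le (by linarith))
    have h2 : ∫ t in a..(x + a), g t = ρ * ∫ t in (0 : ℝ)..x, g t := by
      have h3 := intervalIntegral.integral_comp_add_right (a := 0) (b := x) g a
      rw [zero_add] at h3
      rw [← h3, ← intervalIntegral.integral_const_mul]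
      refine intervalIntegral.integral_congr fun t ht => ?_
      rw [uIcc_of_le hx] at ht
      exact hg t ht.1
    simp only [hG]
    rw [← h1, h2, ← hI]
    field_simp
    ring
  refine ⟨G, hGp, fun x hx => norm_le_of_quasiperiodic ha hGq hρ (fun y hy => ?_) hx⟩
  have hb : ∀ y ∈ Icc 0 a, ‖∫ t in (0 : ℝ)..y, g t‖ ≤ K * a := by
    intro y hy
    refine (intervalIntegral.norm_integral_le_of_norm_le_const (C := K) fun t ht => ?_).trans ?_
    · rw [uIoc_of_le hy.1] at ht
      exact hK t ⟨ht.1.le, ht.2.trans hy.2⟩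
    · rw [sub_zero, abs_of_nonneg hy.1]
      exact mul_le_mul_of_nonneg_left hy.2 hK0
  have hinv : ‖(ρ - 1)⁻¹‖ ≤ 1 / d := by
    rw [norm_inv, ← one_div]
    exact one_div_le_one_div_of_le hd hdρ
  calc ‖G y‖ ≤ ‖∫ t in (0 : ℝ)..y, g t‖ + ‖(ρ - 1)⁻¹ * I‖ := norm_add_le _ _
    _ ≤ K * a + 1 / d * (K * a) := by
      rw [norm_mul]
      exact add_le_add (hb y hy) (mul_le_mul hinv (hb a ⟨ha.le, le_rfl⟩) (norm_nonneg _)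
        (by positivity))
    _ = K * a * (1 + 1 / d) := by ring

/-- `P` and a primitive `G` of `θ P` are bounded by `K exp (κ x)` on the half-line. For an
oscillating factor `θ` this says that `P` is not in resonance with `θ`. -/
structure IsNonresonant (θ : ℝ → ℝ) (K κ : ℝ) (P G : ℝ → ℂ) : Prop where
  primitive : IsACPrimitive G (fun x => (θ x : ℂ) * P x)
  norm_le : ∀ x, 0 ≤ x → ‖P x‖ ≤ K * Real.exp (κ * x)
  norm_primitive_le : ∀ x, 0 ≤ x → ‖G x‖ ≤ K * Real.exp (κ * x)

theorem IsNonresonant.mono {θ : ℝ → ℝ} {K K' κ : ℝ} {P G : ℝ → ℂ} (h : IsNonresonant θ K κ P G)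
    (hK : K ≤ K') : IsNonresonant θ K' κ P G :=
  ⟨h.primitive,
    fun x hx => (h.norm_le x hx).trans (mul_le_mul_of_nonneg_right hK (Real.exp_pos _).le),
    fun x hx => (h.norm_primitive_le x hx).trans
      (mul_le_mul_of_nonneg_right hK (Real.exp_pos _).le)⟩

/-- A quasi-periodic `P` is nonresonant with a sine as soon as its multiplier `ρ`, multiplied by those
of `exp (± 2 i ω x)`, stays away from `1`. The constant depends only on bounds over one period. -/
theorem exists_isNonresonant_sin {a κ K d ω δ : ℝ} (ha : 0 < a) {ρ : ℂ} {P : ℝ → ℂ}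
    (hPc : ContinuousOn P (Ici 0)) (hP : ∀ x, 0 ≤ x → P (x + a) = ρ * P x)
    (hρ : ‖ρ‖ = Real.exp (κ * a)) (hK : ∀ x ∈ Icc 0 a, ‖P x‖ ≤ K) (hd : 0 < d)
    (hdp : d ≤ ‖ρ * Complex.exp (2 * ω * a * Complex.I) - 1‖)
    (hdm : d ≤ ‖ρ * Complex.exp (-(2 * ω * a * Complex.I)) - 1‖) :
    ∃ G : ℝ → ℂ, IsNonresonant (fun x => Real.sin (2 * ω * x + δ))
      (K * (1 + a * (1 + 1 / d)) * Real.exp (|κ| * a)) κ P G := by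
  have hK0 : 0 ≤ K := (norm_nonneg _).trans (hK 0 ⟨le_rfl, ha.le⟩)
  have hu : ∀ t : ℝ, ‖Complex.exp (t * Complex.I)‖ = 1 := Complex.norm_exp_ofReal_mul_I
  have hu' : ∀ t : ℝ, ‖Complex.exp (-(t * Complex.I))‖ = 1 := by
    intro t
    have := hu (-t)
    push_cast at this
    rwa [neg_mul] at this
  have e1 : ∀ x : ℝ, (2 * ω * x + δ : ℂ) * Complex.I = ((2 * ω * x + δ : ℝ) : ℂ) * Complex.I := by
    intro x; push_cast; ring
  have e2 : (2 * ω * a * Complex.I : ℂ) = ((2 * ω * a : ℝ) : ℂ) * Complex.I := by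
    push_cast; ring
  obtain ⟨G₁, hG₁, hb₁⟩ := exists_primitive_of_quasiperiodic (κ := κ) (K := K) ha
    (ρ := ρ * Complex.exp (2 * ω * a * Complex.I))
    (g := fun x => Complex.exp ((2 * ω * x + δ) * Complex.I) * P x)
    ((by fun_prop : Continuous fun x : ℝ =>
      Complex.exp ((2 * ω * x + δ) * Complex.I)).continuousOn.mul hPc)
    (fun x hx => by
      rw [hP x hx, show (2 * ω * ((x + a : ℝ) : ℂ) + δ) * Complex.I =
        2 * ω * a * Complex.I + (2 * ω * x + δ) * Complex.I by push_cast; ring, Complex.exp_add]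
      ring)
    (by rw [norm_mul, e2, hu, mul_one, hρ])
    (fun x hx => by rw [norm_mul, e1, hu, one_mul]; exact hK x hx) hd hdp
  obtain ⟨G₂, hG₂, hb₂⟩ := exists_primitive_of_quasiperiodic (κ := κ) (K := K) ha
    (ρ := ρ * Complex.exp (-(2 * ω * a * Complex.I)))
    (g := fun x => Complex.exp (-((2 * ω * x + δ) * Complex.I)) * P x)
    ((by fun_prop : Continuous fun x : ℝ =>
      Complex.exp (-((2 * ω * x + δ) * Complex.I))).continuousOn.mul hPc)
    (fun x hx => by
      rw [hP x hx, show -((2 * ω * ((x + a : ℝ) : ℂ) + δ) * Complex.I) =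
        -(2 * ω * a * Complex.I) + -((2 * ω * x + δ) * Complex.I) by push_cast; ring,
        Complex.exp_add]
      ring)
    (by rw [norm_mul, e2, hu', mul_one, hρ])
    (fun x hx => by rw [norm_mul, e1, hu', one_mul]; exact hK x hx) hd hdm
  have hexp : 0 ≤ K * a * (1 + 1 / d) := by positivity
  refine ⟨fun x => -Complex.I / 2 * (G₁ x - G₂ x), ⟨?_, fun x hx => ?_, fun x hx => ?_⟩⟩
  · refine ((hG₁.sub hG₂).const_mul (-Complex.I / 2)).congr (fun _ _ => rfl) (fun x _ => ?_)
    rw [Complex.ofReal_sin, Complex.sin, neg_mul]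
    push_cast
    ring
  · refine (norm_le_of_quasiperiodic ha hP hρ hK hx).trans ?_
    gcongr
    refine le_mul_of_one_le_right hK0 ?_
    have : 0 ≤ a * (1 + 1 / d) := by positivity
    linarith
  · rw [norm_mul]
    have h1 : ‖-Complex.I / 2‖ = 1 / 2 := by simp
    have h2 := norm_sub_le (G₁ x) (G₂ x)
    have h3 := hb₁ x hx
    have h4 := hb₂ x hx
    have h5 : K * (1 + a * (1 + 1 / d)) * Real.exp (|κ| * a) * Real.exp (κ * x) =
      K * a * (1 + 1 / d) * Real.exp (|κ| * a) * Real.exp (κ * x) +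
        K * Real.exp (|κ| * a) * Real.exp (κ * x) := by ring
    have h6 : 0 ≤ K * Real.exp (|κ| * a) * Real.exp (κ * x) := by positivity
    rw [h1, h5]
    linarith

/-! ### Asymptotic integration of the system for the amplitudes -/

/-- A slowly decaying amplitude: `h` decreases to `0` in absolute value, its derivative is
integrable, and it is square integrable, but not necessarily integrable. -/
structure IsSlowlyDecaying (h h' : ℝ → ℝ) : Prop where
  primitive : IsACPrimitive h h'
  tendsto_zero : Tendsto h atTop (𝓝 0)
  abs_antitone : ∀ x y, 0 ≤ x → x ≤ y → |h y| ≤ |h x|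
  integrable_deriv : IntegrableOn h' (Ioi 0)
  integrable_sq : IntegrableOn (fun x => h x ^ 2) (Ioi 0)

theorem isSlowlyDecaying_rpow (c : ℝ) {γ : ℝ} (hγ : 1 / 2 < γ) :
    IsSlowlyDecaying (fun x => c / (x + 1) ^ γ) (fun x => c * (-γ * (x + 1) ^ (-γ - 1))) := by
  have hEq : ∀ x : ℝ, 0 ≤ x → c / (x + 1) ^ γ = c * (x + 1) ^ (-γ) := fun x hx => by
    rw [Real.rpow_neg (by linarith), div_eq_mul_inv]
  have hd : ∀ x : ℝ, 0 ≤ x →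
      HasDerivAt (fun x : ℝ => c * (x + 1) ^ (-γ)) (c * (-γ * (x + 1) ^ (-γ - 1))) x := by
    intro x hx
    have := (((hasDerivAt_id x).add_const 1).rpow_const (p := -γ)
      (Or.inl (by simp only [id]; linarith))).const_mul c
    simpa using this
  refine ⟨?_, ?_, ?_, ?_, ?_⟩
  · refine (IsACPrimitive.of_hasDerivWithinAt (fun x hx => (hd x hx).hasDerivWithinAt) ?_).congr
      hEq (fun _ _ => rfl)
    intro x hx
    have hx' : (0 : ℝ) ≤ x := hx
    refine ContinuousAt.continuousWithinAt (continuousAt_const.mul (continuousAt_const.mul ?_))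
    exact (continuousAt_id.add continuousAt_const).rpow_const
      (Or.inl (by simp only [Pi.add_apply, id]; linarith))
  · have h1 : Tendsto (fun x : ℝ => (x + 1) ^ γ) atTop atTop :=
      (tendsto_rpow_atTop (by linarith)).comp (tendsto_atTop_add_const_right _ _ tendsto_id)
    exact tendsto_const_nhds.div_atTop h1
  · intro x y hx hxy
    have h1 : 0 < (x + 1) ^ γ := by positivity
    have h2 : 0 < (y + 1) ^ γ := Real.rpow_pos_of_pos (by linarith) _
    rw [abs_div, abs_div, abs_of_pos h1, abs_of_pos h2]
    refine div_le_div_of_nonneg_left (abs_nonneg _) h1 ?_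
    exact Real.rpow_le_rpow (by linarith) (by linarith) (by linarith)
  · exact ((integrableOn_add_rpow_Ioi_of_lt (by linarith) (by norm_num)).const_mul _).const_mul _
  · have h1 : IntegrableOn (fun x : ℝ => c ^ 2 * (x + 1) ^ (-2 * γ)) (Ioi 0) :=
      (integrableOn_add_rpow_Ioi_of_lt (by linarith) (by norm_num)).const_mul _
    refine h1.congr_fun (fun x hx => ?_) measurableSet_Ioi
    have hx' : (0 : ℝ) < x := hx
    simp only
    rw [hEq x hx'.le, mul_pow, ← Real.rpow_natCast ((x + 1) ^ (-γ)), ← Real.rpow_mul (by linarith)]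
    rw [show -γ * ((2 : ℕ) : ℝ) = -2 * γ by push_cast; ring]

/-- If `T` is the tail of an integral over the half-line, then the integrals over finite intervals
are bounded by `T`, which tends to `0`. -/
theorem tail_integral {r : ℝ → ℝ} (hr : IntegrableOn r (Ioi 0)) (hr0 : ∀ x, 0 ≤ x → 0 ≤ r x) :
    Tendsto (fun x : ℝ => ∫ t in Ioi x, r t) atTop (𝓝 0) ∧
    ∀ x y : ℝ, 0 ≤ x → x ≤ y → IntervalIntegrable r volume x y ∧
      ∫ t in x..y, r t ≤ ∫ t in Ioi x, r t := by
  have hsplit : ∀ x : ℝ, 0 ≤ x →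
      ∫ t in Ioi x, r t = (∫ t in Ioi 0, r t) - ∫ t in (0 : ℝ)..x, r t := by
    intro x hx
    rw [intervalIntegral.integral_of_le hx, ← Ioc_union_Ioi_eq_Ioi hx,
      setIntegral_union (Ioc_disjoint_Ioi le_rfl) measurableSet_Ioi
        (hr.mono_set Ioc_subset_Ioi_self) (hr.mono_set (Ioi_subset_Ioi hx))]
    ring
  refine ⟨?_, fun x y hx hxy => ⟨?_, ?_⟩⟩
  · have h1 := intervalIntegral_tendsto_integral_Ioi (0 : ℝ) hr tendsto_id
    have h2 := h1.const_sub (∫ t in Ioi 0, r t)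
    rw [sub_self] at h2
    refine h2.congr' ?_
    filter_upwards [eventually_ge_atTop (0 : ℝ)] with x hx
    rw [hsplit x hx]
    rfl
  · rw [intervalIntegrable_iff_integrableOn_Ioc_of_le hxy]
    exact hr.mono_set fun t ht => lt_of_le_of_lt hx ht.1
  · rw [intervalIntegral.integral_of_le hxy]
    refine setIntegral_mono_set (hr.mono_set (Ioi_subset_Ioi hx)) ?_
      (Eventually.of_forall fun t ht => ht.1)
    refine (ae_restrict_iff' measurableSet_Ioi).2 (Eventually.of_forall fun t ht => ?_)
    exact hr0 t (hx.trans (le_of_lt ht))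

/-- Bounds for the two components of the matrix with rows `(p, r)`, `(s, p)` applied to `(A, B)`, in
the norm which gives the second component the weight `E' = E⁻¹`. -/
theorem norm_pairing_le {K E E' : ℝ} (hEE : E * E' = 1)
    {p r A B : ℂ} (hp : ‖p‖ ≤ K) (hr : ‖r‖ ≤ K * E') :
    ‖p * A + r * B‖ ≤ K * (‖A‖ + E' * ‖B‖) ∧
    ∀ s : ℂ, ‖s‖ ≤ K * E → ‖s * A + p * B‖ ≤ K * E * (‖A‖ + E' * ‖B‖) := by
  have hA := norm_nonneg A
  have hB := norm_nonneg B
  constructor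
  · refine (norm_add_le _ _).trans ?_
    rw [norm_mul, norm_mul]
    nlinarith [mul_le_mul_of_nonneg_right hp hA, mul_le_mul_of_nonneg_right hr hB]
  · intro s hs
    refine (norm_add_le _ _).trans ?_
    rw [norm_mul, norm_mul]
    have h1 := mul_le_mul_of_nonneg_right hp hB
    have h2 := mul_le_mul_of_nonneg_right hs hA
    calc ‖s‖ * ‖A‖ + ‖p‖ * ‖B‖ ≤ K * E * ‖A‖ + K * ‖B‖ * (E * E') := by rw [hEE]; linarith
      _ = _ := by ring

/-- Asymptotic integration. The amplitudes `A`, `B` satisfy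
`A' = -(h θ + q₁) (P A + R B)`, `B' = (h θ + q₁) (S A + P B)`, with `R` decaying and `S` growing like
`exp (∓ κ x)`. After subtraction of the oscillating terms,
`A + h (GP A + GR B)` and `B - h (GS A + GP B)` have densities which are bounded by an integrable
function times `N = |A| + exp (-κ x) |B|`. This gives the rate of convergence of `A`, and of `B` in the
weighted sense, with bounds which depend on the coefficients only through the constant `K`. -/
theorem amplitude_asymptotics {h h' θ q₁ : ℝ → ℝ} (hh : IsSlowlyDecaying h h')
    (hθ : ∀ x, |θ x| ≤ 1) (hq₁ : IntegrableOn q₁ (Ioi 0)) {K : ℝ} (hK : 0 ≤ K) :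
    ∃ X₀ : ℝ, 0 ≤ X₀ ∧ ∃ τ : ℝ → ℝ, Tendsto τ atTop (𝓝 0) ∧
      ∀ (κ : ℝ) (P GP R GR S GS A B : ℝ → ℂ),
        IsNonresonant θ K 0 P GP → IsNonresonant θ K (-κ) R GR → IsNonresonant θ K κ S GS →
        IsACPrimitive A (fun x => -((h x * θ x + q₁ x : ℝ) * (P x * A x + R x * B x))) →
        IsACPrimitive B (fun x => (h x * θ x + q₁ x : ℝ) * (S x * A x + P x * B x)) →
        ∀ M : ℝ, ‖A X₀‖ + Real.exp (-κ * X₀) * ‖B X₀‖ ≤ M →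
          ∀ x y : ℝ, X₀ ≤ x → x ≤ y → 0 ≤ κ →
            ‖A y - A x‖ ≤ M * τ x ∧ Real.exp (-κ * y) * ‖B y - B x‖ ≤ M * τ x := by
  set H : ℝ := |h 0| with hH
  set r : ℝ → ℝ := fun x => K * |q₁ x| + K * |h' x| + 2 * K ^ 2 * (h x ^ 2 + H * |q₁ x|) with hr
  have hrint : IntegrableOn r (Ioi 0) :=
    ((hq₁.abs.const_mul K).add (hh.integrable_deriv.abs.const_mul K)).add
      ((hh.integrable_sq.add (hq₁.abs.const_mul H)).const_mul _)
  have hr0 : ∀ x, 0 ≤ r x := fun x => by simp only [hr]; positivity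
  obtain ⟨hT, hTle⟩ := tail_integral hrint fun x _ => hr0 x
  set T : ℝ → ℝ := fun x => ∫ t in Ioi x, r t with hTdef
  have habs : Tendsto (fun x => |h x|) atTop (𝓝 0) := by
    simpa using hh.tendsto_zero.abs
  have hKh : Tendsto (fun x => |h x| * K) atTop (𝓝 0) := by simpa using habs.mul_const K
  obtain ⟨X₀, hX₀⟩ := eventually_atTop.1 (((hT.eventually (Iic_mem_nhds
    (show (0 : ℝ) < 1 / 8 by norm_num))).and (hKh.eventually (Iic_mem_nhds
    (show (0 : ℝ) < 1 / 4 by norm_num)))).and (eventually_ge_atTop 0))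
  have hX₀0 : 0 ≤ X₀ := (hX₀ X₀ le_rfl).2
  refine ⟨X₀, hX₀0, fun x => 6 * (T x + 2 * (|h x| * K)), ?_, ?_⟩
  · simpa using (hT.add (hKh.const_mul 2)).const_mul 6
  intro κ P GP R GR S GS A B hP hR hS hA hB M hM x y hx hxy hκ
  set N : ℝ → ℝ := fun x => ‖A x‖ + Real.exp (-κ * x) * ‖B x‖ with hN
  have hN0 : ∀ t, 0 ≤ N t := fun t => by simp only [hN]; positivity
  have hM0 : 0 ≤ M := (hN0 X₀).trans hM
  have hEE : ∀ t : ℝ, Real.exp (κ * t) * Real.exp (-κ * t) = 1 := fun t => by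
    rw [← Real.exp_add]; simp
  -- the amplitudes without their oscillating parts, and their densities
  set UA : ℝ → ℂ := fun t => h t * (GP t * A t + GR t * B t) with hUA
  set UB : ℝ → ℂ := fun t => h t * (GS t * A t + GP t * B t) with hUB
  set DA : ℝ → ℂ := fun t => -(q₁ t) * (P t * A t + R t * B t) + h' t * (GP t * A t + GR t * B t) +
    (h t * (h t * θ t + q₁ t) : ℝ) * (GR t * (S t * A t + P t * B t) -
      GP t * (P t * A t + R t * B t)) with hDA
  set DB : ℝ → ℂ := fun t => q₁ t * (S t * A t + P t * B t) - h' t * (GS t * A t + GP t * B t) -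
    (h t * (h t * θ t + q₁ t) : ℝ) * (GP t * (S t * A t + P t * B t) -
      GS t * (P t * A t + R t * B t)) with hDB
  have hAt : IsACPrimitive (fun t => A t + UA t) DA := by
    refine (hA.add (hh.primitive.ofReal.mul ((hP.primitive.mul hA).add
      (hR.primitive.mul hB)))).congr (fun _ _ => rfl) (fun t _ => ?_)
    simp only [hDA]
    push_cast
    ring
  have hBt : IsACPrimitive (fun t => B t - UB t) DB := by
    refine (hB.sub (hh.primitive.ofReal.mul ((hS.primitive.mul hA).add
      (hP.primitive.mul hB)))).congr (fun _ _ => rfl) (fun t _ => ?_)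
    simp only [hDB]
    push_cast
    ring
  have hP' : ∀ t, 0 ≤ t → ‖P t‖ ≤ K := fun t ht => by simpa using hP.norm_le t ht
  have hGP' : ∀ t, 0 ≤ t → ‖GP t‖ ≤ K := fun t ht => by simpa using hP.norm_primitive_le t ht
  have hPR : ∀ t, 0 ≤ t → ‖P t * A t + R t * B t‖ ≤ K * N t := fun t ht =>
    (norm_pairing_le (hEE t) (hP' t ht) (hR.norm_le t ht)).1
  have hSP : ∀ t, 0 ≤ t → ‖S t * A t + P t * B t‖ ≤ K * Real.exp (κ * t) * N t := fun t ht =>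
    (norm_pairing_le (hEE t) (hP' t ht) (hR.norm_le t ht)).2 _ (hS.norm_le t ht)
  have hGPR : ∀ t, 0 ≤ t → ‖GP t * A t + GR t * B t‖ ≤ K * N t := fun t ht =>
    (norm_pairing_le (hEE t) (hGP' t ht) (hR.norm_primitive_le t ht)).1
  have hGSP : ∀ t, 0 ≤ t → ‖GS t * A t + GP t * B t‖ ≤ K * Real.exp (κ * t) * N t := fun t ht =>
    (norm_pairing_le (hEE t) (hGP' t ht) (hR.norm_primitive_le t ht)).2 _
      (hS.norm_primitive_le t ht)
  have hhQ : ∀ t, 0 ≤ t → |h t * (h t * θ t + q₁ t)| ≤ h t ^ 2 + H * |q₁ t| := by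
    intro t ht
    rw [abs_mul]
    have h1 : |h t * θ t + q₁ t| ≤ |h t| + |q₁ t| := by
      refine (abs_add_le _ _).trans (add_le_add ?_ le_rfl)
      rw [abs_mul]
      exact mul_le_of_le_one_right (abs_nonneg _) (hθ t)
    have h2 : |h t| ≤ H := hh.abs_antitone 0 t le_rfl ht
    have h3 := mul_le_mul_of_nonneg_left h1 (abs_nonneg (h t))
    have h4 := mul_le_mul_of_nonneg_right h2 (abs_nonneg (q₁ t))
    rw [mul_add, abs_mul_abs_self] at h3
    nlinarith
  have hDAle : ∀ t, 0 ≤ t → ‖DA t‖ ≤ r t * N t := by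
    intro t ht
    have e1 : ‖-(q₁ t : ℂ) * (P t * A t + R t * B t)‖ ≤ |q₁ t| * (K * N t) := by
      rw [norm_mul, norm_neg, Complex.norm_real, Real.norm_eq_abs]
      exact mul_le_mul_of_nonneg_left (hPR t ht) (abs_nonneg _)
    have e2 : ‖(h' t : ℂ) * (GP t * A t + GR t * B t)‖ ≤ |h' t| * (K * N t) := by
      rw [norm_mul, Complex.norm_real, Real.norm_eq_abs]
      exact mul_le_mul_of_nonneg_left (hGPR t ht) (abs_nonneg _)
    have e4 : ‖GR t * (S t * A t + P t * B t) - GP t * (P t * A t + R t * B t)‖ ≤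
        2 * K ^ 2 * N t := by
      refine (norm_sub_le _ _).trans ?_
      rw [norm_mul, norm_mul]
      have f1 : ‖GR t‖ * ‖S t * A t + P t * B t‖ ≤
          K * Real.exp (-κ * t) * (K * Real.exp (κ * t) * N t) :=
        mul_le_mul (hR.norm_primitive_le t ht) (hSP t ht) (norm_nonneg _) (by positivity)
      have f2 : ‖GP t‖ * ‖P t * A t + R t * B t‖ ≤ K * (K * N t) :=
        mul_le_mul (hGP' t ht) (hPR t ht) (norm_nonneg _) hK
      have f3 : K * Real.exp (-κ * t) * (K * Real.exp (κ * t) * N t) = K ^ 2 * N t *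
          (Real.exp (κ * t) * Real.exp (-κ * t)) := by ring
      rw [f3, hEE, mul_one] at f1
      nlinarith
    have e3 : ‖((h t * (h t * θ t + q₁ t) : ℝ) : ℂ) * (GR t * (S t * A t + P t * B t) -
        GP t * (P t * A t + R t * B t))‖ ≤ (h t ^ 2 + H * |q₁ t|) * (2 * K ^ 2 * N t) := by
      rw [norm_mul, Complex.norm_real, Real.norm_eq_abs]
      exact mul_le_mul (hhQ t ht) e4 (norm_nonneg _) (by positivity)
    refine (norm_add_le _ _).trans ((add_le_add ((norm_add_le _ _).trans (add_le_add e1 e2))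
      e3).trans (le_of_eq ?_))
    simp only [hr]
    ring
  have hDBle : ∀ t, 0 ≤ t → ‖DB t‖ ≤ Real.exp (κ * t) * (r t * N t) := by
    intro t ht
    have e1 : ‖(q₁ t : ℂ) * (S t * A t + P t * B t)‖ ≤ |q₁ t| * (K * Real.exp (κ * t) * N t) := by
      rw [norm_mul, Complex.norm_real, Real.norm_eq_abs]
      exact mul_le_mul_of_nonneg_left (hSP t ht) (abs_nonneg _)
    have e2 : ‖(h' t : ℂ) * (GS t * A t + GP t * B t)‖ ≤
        |h' t| * (K * Real.exp (κ * t) * N t) := by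
      rw [norm_mul, Complex.norm_real, Real.norm_eq_abs]
      exact mul_le_mul_of_nonneg_left (hGSP t ht) (abs_nonneg _)
    have e4 : ‖GP t * (S t * A t + P t * B t) - GS t * (P t * A t + R t * B t)‖ ≤
        2 * K ^ 2 * Real.exp (κ * t) * N t := by
      refine (norm_sub_le _ _).trans ?_
      rw [norm_mul, norm_mul]
      have f1 : ‖GP t‖ * ‖S t * A t + P t * B t‖ ≤ K * (K * Real.exp (κ * t) * N t) :=
        mul_le_mul (hGP' t ht) (hSP t ht) (norm_nonneg _) hK
      have f2 : ‖GS t‖ * ‖P t * A t + R t * B t‖ ≤ K * Real.exp (κ * t) * (K * N t) :=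
        mul_le_mul (hS.norm_primitive_le t ht) (hPR t ht) (norm_nonneg _) (by positivity)
      nlinarith
    have e3 : ‖((h t * (h t * θ t + q₁ t) : ℝ) : ℂ) * (GP t * (S t * A t + P t * B t) -
        GS t * (P t * A t + R t * B t))‖ ≤
        (h t ^ 2 + H * |q₁ t|) * (2 * K ^ 2 * Real.exp (κ * t) * N t) := by
      rw [norm_mul, Complex.norm_real, Real.norm_eq_abs]
      exact mul_le_mul (hhQ t ht) e4 (norm_nonneg _) (by positivity)
    refine (norm_sub_le _ _).trans ((add_le_add ((norm_sub_le _ _).trans (add_le_add e1 e2))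
      e3).trans (le_of_eq ?_))
    simp only [hr]
    ring
  have hUAle : ∀ t, 0 ≤ t → ‖UA t‖ ≤ |h t| * K * N t := by
    intro t ht
    simp only [hUA]
    rw [norm_mul, Complex.norm_real, Real.norm_eq_abs, mul_assoc]
    exact mul_le_mul_of_nonneg_left (hGPR t ht) (abs_nonneg _)
  have hUBle : ∀ t, 0 ≤ t → ∀ s, t ≤ s → Real.exp (-κ * s) * ‖UB t‖ ≤ |h t| * K * N t := by
    intro t ht s hts
    simp only [hUB]
    rw [norm_mul, Complex.norm_real, Real.norm_eq_abs]
    have h1 := mul_le_mul_of_nonneg_left (hGSP t ht) (abs_nonneg (h t))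
    have h2 : Real.exp (-κ * s) * Real.exp (κ * t) ≤ 1 := by
      rw [← Real.exp_add, Real.exp_le_one_iff]
      nlinarith
    calc Real.exp (-κ * s) * (|h t| * ‖GS t * A t + GP t * B t‖)
        ≤ Real.exp (-κ * s) * (|h t| * (K * Real.exp (κ * t) * N t)) :=
          mul_le_mul_of_nonneg_left h1 (Real.exp_pos _).le
      _ = (Real.exp (-κ * s) * Real.exp (κ * t)) * (|h t| * K * N t) := by ring
      _ ≤ 1 * (|h t| * K * N t) :=
          mul_le_mul_of_nonneg_right h2 (by have := hN0 t; positivity)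
      _ = _ := one_mul _
  -- increments of the amplitudes, in terms of a bound `m` for `N`
  have incr : ∀ m x y : ℝ, X₀ ≤ x → x ≤ y → (∀ t ∈ Icc x y, N t ≤ m) →
      ‖(A y + UA y) - (A x + UA x)‖ ≤ m * T x ∧
      Real.exp (-κ * y) * ‖(B y - UB y) - (B x - UB x)‖ ≤ m * T x := by
    intro m x y hx hxy hm
    have hx0 : 0 ≤ x := hX₀0.trans hx
    have hm0 : 0 ≤ m := (hN0 x).trans (hm x ⟨le_rfl, hxy⟩)
    obtain ⟨hri, hrT⟩ := hTle x y hx0 hxy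
    constructor
    · refine (hAt.norm_sub_le (w := fun t => m * r t) hx0 hxy (hri.const_mul m)
        fun t ht => ?_).trans ?_
      · refine (hDAle t (hx0.trans ht.1)).trans ?_
        rw [mul_comm m]
        exact mul_le_mul_of_nonneg_left (hm t ht) (hr0 t)
      · rw [intervalIntegral.integral_const_mul]
        exact mul_le_mul_of_nonneg_left hrT hm0
    · have h1 := hBt.norm_sub_le (w := fun t => Real.exp (κ * y) * m * r t) hx0 hxy
        (hri.const_mul _) fun t ht => ?_
      · rw [intervalIntegral.integral_const_mul] at h1
        calc _ ≤ Real.exp (-κ * y) * (Real.exp (κ * y) * m * ∫ t in x..y, r t) :=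
              mul_le_mul_of_nonneg_left h1 (Real.exp_pos _).le
          _ = (Real.exp (κ * y) * Real.exp (-κ * y)) * (m * ∫ t in x..y, r t) := by ring
          _ ≤ m * T x := by
              rw [hEE, one_mul]
              exact mul_le_mul_of_nonneg_left hrT hm0
      · refine (hDBle t (hx0.trans ht.1)).trans ?_
        have h2 : Real.exp (κ * t) ≤ Real.exp (κ * y) :=
          Real.exp_le_exp.2 (mul_le_mul_of_nonneg_left ht.2 hκ)
        calc _ ≤ Real.exp (κ * y) * (r t * m) :=
              mul_le_mul h2 (mul_le_mul_of_nonneg_left (hm t ht) (hr0 t))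
                (mul_nonneg (hr0 t) (hN0 t)) (Real.exp_pos _).le
          _ = _ := by ring
  -- the bound `N ≤ 6 M`, by absorption
  have hNle : ∀ z, X₀ ≤ z → N z ≤ 6 * M := by
    intro z hz
    have hNc : ContinuousOn N (Icc X₀ z) := by
      have hs : Icc X₀ z ⊆ Ici 0 := fun t ht => hX₀0.trans ht.1
      exact ((hA.continuousOn.mono hs).norm).add
        ((by fun_prop : Continuous fun t : ℝ => Real.exp (-κ * t)).continuousOn.mul
          (hB.continuousOn.mono hs).norm)
    obtain ⟨s, hs, hsmax⟩ := isCompact_Icc.exists_isMaxOn ⟨z, hz, le_rfl⟩ hNc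
    have hmax : ∀ t ∈ Icc X₀ z, N t ≤ N s := fun t ht => hsmax ht
    refine (hmax z ⟨hz, le_rfl⟩).trans ?_
    obtain ⟨i1, i2⟩ := incr (N s) X₀ s le_rfl hs.1 fun t ht => hmax t ⟨ht.1, ht.2.trans hs.2⟩
    have hTs : T X₀ ≤ 1 / 8 := (hX₀ X₀ le_rfl).1.1
    have hh1 : |h X₀| * K ≤ 1 / 4 := (hX₀ X₀ le_rfl).1.2
    have hh2 : |h s| * K ≤ 1 / 4 := (hX₀ s hs.1).1.2
    have a1 := hUAle X₀ hX₀0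
    have a2 := hUAle s (hX₀0.trans hs.1)
    have b1 := hUBle X₀ hX₀0 s hs.1
    have b2 := hUBle s (hX₀0.trans hs.1) s le_rfl
    have hE : Real.exp (-κ * s) ≤ Real.exp (-κ * X₀) :=
      Real.exp_le_exp.2 (by nlinarith [hs.1])
    have n1 : ‖A s‖ ≤ ‖(A s + UA s) - (A X₀ + UA X₀)‖ + ‖A X₀‖ + ‖UA X₀‖ + ‖UA s‖ := by
      have e : A s = ((A s + UA s) - (A X₀ + UA X₀)) + A X₀ + UA X₀ - UA s := by ring
      calc ‖A s‖ = ‖((A s + UA s) - (A X₀ + UA X₀)) + A X₀ + UA X₀ - UA s‖ := by rw [← e]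
        _ ≤ _ := (norm_sub_le _ _).trans (add_le_add (norm_add₃_le) le_rfl)
    have n2 : ‖B s‖ ≤ ‖(B s - UB s) - (B X₀ - UB X₀)‖ + ‖B X₀‖ + ‖UB s‖ + ‖UB X₀‖ := by
      have e : B s = ((B s - UB s) - (B X₀ - UB X₀)) + B X₀ + UB s - UB X₀ := by ring
      calc ‖B s‖ = ‖((B s - UB s) - (B X₀ - UB X₀)) + B X₀ + UB s - UB X₀‖ := by rw [← e]
        _ ≤ _ := (norm_sub_le _ _).trans (add_le_add (norm_add₃_le) le_rfl)
    have n2' := mul_le_mul_of_nonneg_left n2 (Real.exp_pos (-κ * s)).le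
    have n3 := mul_le_mul_of_nonneg_right hE (norm_nonneg (B X₀))
    have hNs : N s = ‖A s‖ + Real.exp (-κ * s) * ‖B s‖ := rfl
    have hNX : N X₀ = ‖A X₀‖ + Real.exp (-κ * X₀) * ‖B X₀‖ := rfl
    have hM' : N X₀ ≤ M := hM
    have c1 := mul_le_mul_of_nonneg_left hTs (hN0 s)
    have c2 := mul_le_mul_of_nonneg_right hh1 (hN0 X₀)
    have c3 := mul_le_mul_of_nonneg_right hh2 (hN0 s)
    nlinarith
  obtain ⟨i1, i2⟩ := incr (6 * M) x y hx hxy fun t ht => hNle t (hx.trans ht.1)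
  have hx0 : 0 ≤ x := hX₀0.trans hx
  have hy0 : 0 ≤ y := hx0.trans hxy
  have hmono := hh.abs_antitone x y hx0 hxy
  have u1 : |h x| * K * N x ≤ |h x| * K * (6 * M) :=
    mul_le_mul_of_nonneg_left (hNle x hx) (by positivity)
  have u2 : |h y| * K * N y ≤ |h x| * K * (6 * M) :=
    mul_le_mul (mul_le_mul_of_nonneg_right hmono hK) (hNle y (hx.trans hxy)) (hN0 y)
      (by positivity)
  constructor
  · have n1 : ‖A y - A x‖ ≤ ‖(A y + UA y) - (A x + UA x)‖ + ‖UA x‖ + ‖UA y‖ := by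
      have e : A y - A x = ((A y + UA y) - (A x + UA x)) + UA x - UA y := by ring
      calc ‖A y - A x‖ = ‖((A y + UA y) - (A x + UA x)) + UA x - UA y‖ := by rw [← e]
        _ ≤ _ := (norm_sub_le _ _).trans (add_le_add (norm_add_le _ _) le_rfl)
    have := hUAle x hx0
    have := hUAle y hy0
    nlinarith
  · have n2 : ‖B y - B x‖ ≤ ‖(B y - UB y) - (B x - UB x)‖ + ‖UB y‖ + ‖UB x‖ := by
      have e : B y - B x = ((B y - UB y) - (B x - UB x)) + UB y - UB x := by ring
      calc ‖B y - B x‖ = ‖((B y - UB y) - (B x - UB x)) + UB y - UB x‖ := by rw [← e]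
        _ ≤ _ := (norm_sub_le _ _).trans (add_le_add (norm_add_le _ _) le_rfl)
    have n2' := mul_le_mul_of_nonneg_left n2 (Real.exp_pos (-κ * y)).le
    have := hUBle x hx0 y hxy
    have := hUBle y hy0 y le_rfl
    nlinarith

/-! ### Local integrability of the potentials -/

theorem intervalIntegrable_perturbedPotential {q q₁ : ℝ → ℝ} {c ω δ γ : ℝ}
    (hq : ∀ x, 0 ≤ x → IntervalIntegrable q volume 0 x) (hq₁ : IntegrableOn q₁ (Ioi 0)) {x : ℝ}
    (hx : 0 ≤ x) : IntervalIntegrable (perturbedPotential q q₁ c ω δ γ) volume 0 x := by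
  refine ((hq x hx).add ?_).add ?_
  · refine ContinuousOn.intervalIntegrable fun t ht => ContinuousAt.continuousWithinAt ?_
    rw [uIcc_of_le hx] at ht
    have h1 : t + 1 ≠ 0 := by linarith [ht.1]
    have h2 : (t + 1) ^ γ ≠ 0 := (Real.rpow_pos_of_pos (by linarith [ht.1]) _).ne'
    refine ContinuousAt.div (by fun_prop) ?_ h2
    exact (continuousAt_id.add continuousAt_const).rpow_const (Or.inl h1)
  · rw [intervalIntegrable_iff_integrableOn_Ioc_of_le hx]
    exact hq₁.mono_set Ioc_subset_Ioi_self

/-! ### Bloch solutions -/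

theorem isOpen_upperHalf : IsOpen upperHalf := isOpen_lt continuous_const Complex.continuous_im

theorem upperHalf_subset_blochDomain (l m : ℕ → ℝ) : upperHalf ⊆ blochDomain l m :=
  subset_union_left

theorem blochDomain_subset_closedUpperHalf (l m : ℕ → ℝ) :
    blochDomain l m ⊆ closedUpperHalf := by
  rintro z (hz | ⟨t, _, rfl⟩)
  · exact le_of_lt (show 0 < z.im from hz)
  · simp [closedUpperHalf]

/-- The derivative of a quasi-periodic solution has the same multiplier. -/
theorem IsSchrodingerSolution.deriv_quasiperiodic {V : ℝ → ℝ} {z ρ : ℂ} {f f' : ℝ → ℂ} {a : ℝ}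
    (ha : 0 < a) (hf : IsSchrodingerSolution V z f f') (hρ : ∀ x, 0 ≤ x → f (x + a) = ρ * f x)
    {x : ℝ} (hx : 0 ≤ x) : f' (x + a) = ρ * f' x := by
  have h1 : HasDerivWithinAt (fun y => f (y + a)) (f' (x + a)) (Ici 0) x := by
    have h2 := hf.1 (x + a) (by linarith)
    have h3 : HasDerivWithinAt (fun y : ℝ => y + a) 1 (Ici 0) x :=
      ((hasDerivAt_id x).add_const a).hasDerivWithinAt
    have h4 := HasDerivWithinAt.scomp x h2 h3
      (fun y hy => show (0 : ℝ) ≤ y + a by have : (0 : ℝ) ≤ y := hy; linarith)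
    simpa [Function.comp_def] using h4
  have h2 : HasDerivWithinAt (fun y => f (y + a)) (ρ * f' x) (Ici 0) x :=
    ((hf.1 x hx).const_mul ρ).congr (fun y hy => hρ y hy) (hρ x hx)
  exact (uniqueDiffOn_Ici (0 : ℝ) x hx).eq_deriv _ h1 h2

/-- The Wronskian of two solutions of the same equation does not depend on the point. -/
theorem IsSchrodingerSolution.wronskian_eq {V : ℝ → ℝ} {z : ℂ} {f f' g g' : ℝ → ℂ}
    (hf : IsSchrodingerSolution V z f f') (hg : IsSchrodingerSolution V z g g')
    (hV : ∀ x, 0 ≤ x → IntervalIntegrable V volume 0 x) {x : ℝ} (hx : 0 ≤ x) :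
    f' x * g x - f x * g' x = wronskianAtZero f f' g g' := by
  have h1 := hf.isACPrimitive hV
  have h2 := hg.isACPrimitive hV
  exact ((h1.2.mul h2.1).sub (h1.1.mul h2.2)).eq_zero_add_of_density_zero
    (fun t _ => by ring) hx

/-- The Wronskian of the Bloch solutions. -/
noncomputable def blochWronskian (ψp ψp' ψm ψm' : ℝ → ℂ → ℂ) (z : ℂ) : ℂ :=
  wronskianAtZero (fun x => ψp x z) (fun x => ψp' x z) (fun x => ψm x z) (fun x => ψm' x z)

section Bloch

variable {q : ℝ → ℝ} {a : ℝ} {l m : ℕ → ℝ} {k : ℂ → ℂ} {ψp ψp' ψm ψm' : ℝ → ℂ → ℂ}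

/-- The solutions with Cauchy data `(1, 0)` and `(0, 1)`, as combinations of the Bloch
solutions. -/
theorem IsBlochPair.exists_fundamental (hψ : IsBlochPair q a l m k ψp ψp' ψm ψm')
    (hq : ∀ x, 0 ≤ x → IntervalIntegrable q volume 0 x) :
    ∃ c c' s s' : ℝ → ℂ → ℂ, IsFixedDataFamily q (blochDomain l m) 1 0 c c' ∧
      IsFixedDataFamily q (blochDomain l m) 0 1 s s' := by
  set W := blochWronskian ψp ψp' ψm ψm' with hW
  have hne : ∀ z ∈ blochDomain l m, W z ≠ 0 := hψ.wronskian_ne_zero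
  have hWz : ∀ z, W z = ψp' 0 z * ψm 0 z - ψp 0 z * ψm' 0 z := fun z => rfl
  refine ⟨fun x z => -ψm' 0 z / W z * ψp x z + ψp' 0 z / W z * ψm x z,
    fun x z => -ψm' 0 z / W z * ψp' x z + ψp' 0 z / W z * ψm' x z,
    fun x z => ψm 0 z / W z * ψp x z + -ψp 0 z / W z * ψm x z,
    fun x z => ψm 0 z / W z * ψp' x z + -ψp 0 z / W z * ψm' x z,
    ⟨fun z hz => ?_, fun z hz => ?_, fun z hz => ?_⟩, ⟨fun z hz => ?_, fun z hz => ?_, fun z hz => ?_⟩⟩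
  · exact (hψ.sol_plus z hz).linear_combination (hψ.sol_minus z hz) hq _ _
  · have := hne z hz
    field_simp
    rw [hWz z]
    ring
  · have := hne z hz
    field_simp
    ring
  · exact (hψ.sol_plus z hz).linear_combination (hψ.sol_minus z hz) hq _ _
  · have := hne z hz
    field_simp
    ring
  · have := hne z hz
    field_simp
    rw [hWz z]
    ring

theorem IsBlochPair.continuousOn_deriv (hψ : IsBlochPair q a l m k ψp ψp' ψm ψm')
    (hq : ∀ x, 0 ≤ x → IntervalIntegrable q volume 0 x) {x : ℝ} (hx : 0 ≤ x) :
    ContinuousOn (ψp' x) (blochDomain l m) ∧ ContinuousOn (ψm' x) (blochDomain l m) := by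
  obtain ⟨c, c', s, s', hc, hs⟩ := hψ.exists_fundamental hq
  exact ⟨fun z hz => (deriv_regular_of_value_regular hq hc hs hψ.sol_plus hx hz).1
      fun t ht => hψ.continuous_plus t ht z hz,
    fun z hz => (deriv_regular_of_value_regular hq hc hs hψ.sol_minus hx hz).1
      fun t ht => hψ.continuous_minus t ht z hz⟩

theorem IsBlochPair.differentiableAt_deriv (hψ : IsBlochPair q a l m k ψp ψp' ψm ψm')
    (hq : ∀ x, 0 ≤ x → IntervalIntegrable q volume 0 x) {x : ℝ} (hx : 0 ≤ x) {z : ℂ}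
    (hz : z ∈ upperHalf) : DifferentiableAt ℂ (ψp' x) z ∧ DifferentiableAt ℂ (ψm' x) z := by
  obtain ⟨c, c', s, s', hc, hs⟩ := hψ.exists_fundamental hq
  have hΩ : blochDomain l m ∈ 𝓝 z :=
    mem_of_superset (isOpen_upperHalf.mem_nhds hz) (upperHalf_subset_blochDomain l m)
  have hz' := upperHalf_subset_blochDomain l m hz
  exact ⟨(deriv_regular_of_value_regular hq hc hs hψ.sol_plus hx hz').2
      (fun t ht => (hψ.analytic_plus t ht z hz).differentiableAt) hΩ,
    (deriv_regular_of_value_regular hq hc hs hψ.sol_minus hx hz').2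
      (fun t ht => (hψ.analytic_minus t ht z hz).differentiableAt) hΩ⟩

/-- The Bloch solutions are bounded on one period, locally uniformly in the spectral parameter. -/
theorem IsBlochPair.eventually_bounded (hψ : IsBlochPair q a l m k ψp ψp' ψm ψm')
    (ha : 0 < a) (hq : ∀ x, 0 ≤ x → IntervalIntegrable q volume 0 x) {z₀ : ℂ}
    (hz₀ : z₀ ∈ blochDomain l m) :
    ∃ K : ℝ, 0 ≤ K ∧ ∀ᶠ z in 𝓝[blochDomain l m] z₀, ∀ x ∈ Icc 0 a,
      ‖ψp x z‖ + ‖ψp' x z‖ ≤ K ∧ ‖ψm x z‖ + ‖ψm' x z‖ ≤ K := by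
  have hcp : ContinuousWithinAt (fun z => ‖ψp 0 z‖ + ‖ψp' 0 z‖) (blochDomain l m) z₀ :=
    (hψ.continuous_plus 0 le_rfl z₀ hz₀).norm.add ((hψ.continuousOn_deriv hq le_rfl).1 z₀ hz₀).norm
  have hcm : ContinuousWithinAt (fun z => ‖ψm 0 z‖ + ‖ψm' 0 z‖) (blochDomain l m) z₀ :=
    (hψ.continuous_minus 0 le_rfl z₀ hz₀).norm.add
      ((hψ.continuousOn_deriv hq le_rfl).2 z₀ hz₀).norm
  set Kp := ‖ψp 0 z₀‖ + ‖ψp' 0 z₀‖ + 1 with hKp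
  set Km := ‖ψm 0 z₀‖ + ‖ψm' 0 z₀‖ + 1 with hKm
  set g := growthFactor q (‖z₀‖ + 1) a
  have hg : 0 < g := growthFactor_pos _ _ _
  have hp0 : 0 ≤ Kp := by positivity
  have hm0 : 0 ≤ Km := by positivity
  refine ⟨(Kp + Km) * g, by positivity, ?_⟩
  have hn : ∀ᶠ z in 𝓝[blochDomain l m] z₀, ‖z‖ < ‖z₀‖ + 1 :=
    (continuous_norm.continuousWithinAt (s := blochDomain l m) (x := z₀)).eventually
      (Iio_mem_nhds (by simp))
  filter_upwards [hcp.eventually (Iio_mem_nhds (lt_add_one _)),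
    hcm.eventually (Iio_mem_nhds (lt_add_one _)), hn, self_mem_nhdsWithin] with z h1 h2 h3 hz x hx
  have e : ∀ f f' : ℝ → ℂ, IsSchrodingerSolution q z f f' →
      ‖f x‖ + ‖f' x‖ ≤ (‖f 0‖ + ‖f' 0‖) * g := by
    intro f f' hf
    have hs := hf.isACPrimitive hq
    have := norm_add_norm_le_growthFactor (g := fun _ => 0) (M := 0) hq h3.le hs.1
      (hs.2.congr (fun _ _ => rfl) (fun x _ => by ring)) ha.le (by simp) x hx
    simpa using this
  have h1' : ‖ψp 0 z‖ + ‖ψp' 0 z‖ ≤ Kp + Km := by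
    have : ‖ψp 0 z‖ + ‖ψp' 0 z‖ < Kp := h1
    linarith
  have h2' : ‖ψm 0 z‖ + ‖ψm' 0 z‖ ≤ Kp + Km := by
    have : ‖ψm 0 z‖ + ‖ψm' 0 z‖ < Km := h2
    linarith
  exact ⟨(e _ _ (hψ.sol_plus z hz)).trans (mul_le_mul_of_nonneg_right h1' hg.le),
    (e _ _ (hψ.sol_minus z hz)).trans (mul_le_mul_of_nonneg_right h2' hg.le)⟩

/-- The Bloch solutions and their derivatives decay and grow like `exp (∓ Im k x / a)`. -/
theorem IsBlochPair.exists_norm_le (hψ : IsBlochPair q a l m k ψp ψp' ψm ψm')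
    (ha : 0 < a) (hq : ∀ x, 0 ≤ x → IntervalIntegrable q volume 0 x) {z : ℂ}
    (hz : z ∈ blochDomain l m) :
    ∃ K : ℝ, ∀ x, 0 ≤ x → ‖ψp x z‖ ≤ K * Real.exp (-((k z).im / a) * x) ∧
      ‖ψp' x z‖ ≤ K * Real.exp (-((k z).im / a) * x) ∧
      ‖ψm x z‖ ≤ K * Real.exp ((k z).im / a * x) ∧
      ‖ψm' x z‖ ≤ K * Real.exp ((k z).im / a * x) := by
  obtain ⟨K, hK0, hK⟩ := hψ.eventually_bounded ha hq hz
  have hK := hK.self_of_nhdsWithin hz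
  have hp : ‖Complex.exp (Complex.I * k z)‖ = Real.exp (-((k z).im / a) * a) := by
    rw [Complex.norm_exp]
    congr 1
    simp
    field_simp
  have hm : ‖Complex.exp (-(Complex.I * k z))‖ = Real.exp ((k z).im / a * a) := by
    rw [Complex.norm_exp]
    congr 1
    simp
    field_simp
  have hb : ∀ x ∈ Icc 0 a, ‖ψp x z‖ ≤ K ∧ ‖ψp' x z‖ ≤ K ∧ ‖ψm x z‖ ≤ K ∧ ‖ψm' x z‖ ≤ K := by
    intro x hx
    obtain ⟨h1, h2⟩ := hK x hx
    have := norm_nonneg (ψp x z)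
    have := norm_nonneg (ψp' x z)
    have := norm_nonneg (ψm x z)
    have := norm_nonneg (ψm' x z)
    exact ⟨by linarith, by linarith, by linarith, by linarith⟩
  have hp' := fun x (hx : 0 ≤ x) =>
    (hψ.sol_plus z hz).deriv_quasiperiodic ha (hψ.quasiperiodic_plus z hz) hx
  have hm' := fun x (hx : 0 ≤ x) =>
    (hψ.sol_minus z hz).deriv_quasiperiodic ha (hψ.quasiperiodic_minus z hz) hx
  refine ⟨K * Real.exp (|(k z).im / a| * a), fun x hx => ⟨?_, ?_, ?_, ?_⟩⟩
  · have := norm_le_of_quasiperiodic ha (hψ.quasiperiodic_plus z hz) hp (fun x hx => (hb x hx).1) hx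
    rwa [abs_neg] at this
  · have := norm_le_of_quasiperiodic ha hp' hp (fun x hx => (hb x hx).2.1) hx
    rwa [abs_neg] at this
  · exact norm_le_of_quasiperiodic ha (hψ.quasiperiodic_minus z hz) hm
      (fun x hx => (hb x hx).2.2.1) hx
  · exact norm_le_of_quasiperiodic ha hm' hm (fun x hx => (hb x hx).2.2.2) hx

/-! ### Nonresonance off the critical points -/

/-- A point with a nonzero solution that is periodic up to the sign `s` is an eigenvalue. -/
theorem IsEigenvalueSequence.mem_range {s : ℂ} {e : ℕ → ℝ} (he : IsEigenvalueSequence q a s e)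
    {t : ℝ} {f f' : ℝ → ℂ} (hf : IsSchrodingerSolution q t f f') (h0 : f a = s * f 0)
    (h0' : f' a = s * f' 0) (hne : f 0 ≠ 0 ∨ f' 0 ≠ 0) : t ∈ range e := by
  by_contra hcon
  have hempty : {n : ℕ | e n = t} = ∅ := by
    ext n
    simp only [mem_ofPred_eq, mem_empty_iff_false, iff_false]
    exact fun h => hcon ⟨n, h⟩
  have h1 := he.2 t
  rw [hempty, encard_empty] at h1
  have h2 : eigenMultiplicity q a s t = 0 := by exact_mod_cast h1.symm
  unfold eigenMultiplicity Set.finrank at h2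
  rw [Submodule.finrank_eq_zero, Submodule.span_eq_bot] at h2
  have h3 := h2 (f 0, f' 0) ⟨f, f', hf, rfl, rfl, h0, h0'⟩
  rw [Prod.mk_eq_zero] at h3
  tauto

/-- The quasi-momentum is nonnegative on the spectrum. At a zero of `k` in the interior of a band
the Bloch solution `ψ₊` is periodic, so that this point would be a periodic eigenvalue; hence `k`
vanishes only at `l 0`, and the intermediate value theorem excludes negative values. -/
theorem IsQuasiMomentum.re_nonneg (hk : IsQuasiMomentum q a l m k)
    (hl : IsEigenvalueSequence q a 1 l) (hψ : IsBlochPair q a l m k ψp ψp' ψm ψm') (ha : 0 < a)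
    {t : ℝ} (ht : t ∈ bandSpectrum l m) : 0 ≤ (k t).re := by
  have hpi := Real.pi_pos
  have hlval : ∀ n, 0 ≤ (k (l n)).re ∧ (n ≠ 0 → 0 < (k (l n)).re) := by
    intro n
    rcases Nat.even_or_odd' n with ⟨j, rfl | rfl⟩
    · rcases j with _ | j
      · simp [hk.at_periodic_zero]
      · rw [show 2 * (j + 1) = 2 * j + 2 by ring, (hk.at_periodic j).2, Complex.ofReal_re]
        exact ⟨by positivity, fun _ => by positivity⟩
    · rw [(hk.at_periodic j).1, Complex.ofReal_re]
      exact ⟨by positivity, fun _ => by positivity⟩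
  have hmval : ∀ n, 0 < (k (m n)).re := by
    intro n
    rcases Nat.even_or_odd' n with ⟨j, rfl | rfl⟩
    · rw [(hk.at_antiperiodic j).1, Complex.ofReal_re]; positivity
    · rw [(hk.at_antiperiodic j).2, Complex.ofReal_re]; positivity
  have hzero : ∀ s ∈ bandSpectrum l m, (k s).re = 0 → s = l 0 := by
    intro s hs h0
    have hks : k s = 0 := Complex.ext h0 (hk.real_on_spectrum s hs)
    by_cases hsl : s ∈ range l
    · obtain ⟨n, rfl⟩ := hsl
      by_contra hne
      have := (hlval n).2 (fun h => hne (by rw [h]))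
      linarith
    by_cases hsm : s ∈ range m
    · obtain ⟨n, rfl⟩ := hsm
      have := hmval n
      linarith
    · have hin : s ∈ bandInterior l m := ⟨hs, fun h => h.elim hsl hsm⟩
      have hD : (s : ℂ) ∈ blochDomain l m := Or.inr ⟨s, hin, rfl⟩
      have h1 := hψ.quasiperiodic_plus s hD 0 le_rfl
      have h2 := (hψ.sol_plus s hD).deriv_quasiperiodic ha (hψ.quasiperiodic_plus s hD) le_rfl
      simp only [hks, mul_zero, Complex.exp_zero, zero_add] at h1 h2
      refine absurd (hl.mem_range (hψ.sol_plus s hD) h1 h2 ?_) hsl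
      by_contra! hcon
      refine hψ.wronskian_ne_zero s hD ?_
      simp [wronskianAtZero, hcon.1, hcon.2]
  -- the argument on a single band `[u, v]`
  have hband : ∀ u v : ℝ, Icc u v ⊆ bandSpectrum l m → 0 ≤ (k u).re → 0 ≤ (k v).re →
      t ∈ Icc u v → 0 ≤ (k t).re := by
    intro u v hsub hu hv htuv
    by_contra! hneg
    have hcont : Continuous fun x : ℝ => (k x).re := by
      refine Complex.continuous_re.comp (hk.continuousOn.comp_continuous Complex.continuous_ofReal
        fun x => ?_)
      simp [closedUpperHalf]
    obtain ⟨s, hs, hs0⟩ := intermediate_value_Icc' htuv.1 hcont.continuousOn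
      (show (0 : ℝ) ∈ Icc ((k t).re) ((k u).re) from ⟨hneg.le, hu⟩)
    obtain ⟨s', hs', hs0'⟩ := intermediate_value_Icc htuv.2 hcont.continuousOn
      (show (0 : ℝ) ∈ Icc ((k t).re) ((k v).re) from ⟨hneg.le, hv⟩)
    have e1 := hzero s (hsub ⟨hs.1, hs.2.trans htuv.2⟩) hs0
    have e2 := hzero s' (hsub ⟨htuv.1.trans hs'.1, hs'.2⟩) hs0'
    have e3 : t = s := le_antisymm (by rw [e1, ← e2]; exact hs'.1) hs.2
    rw [e3] at hneg
    simp only at hs0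
    linarith
  obtain ⟨n, hn | hn⟩ := mem_iUnion.1 ht
  · exact hband _ _ (fun s hs => mem_iUnion.2 ⟨n, Or.inl hs⟩) (hlval _).1 (hmval _).le hn
  · exact hband _ _ (fun s hs => mem_iUnion.2 ⟨n, Or.inr hs⟩) (hmval _).le (hlval _).1 hn

/-- The set on which the asymptotics are considered: the open upper half-plane together with the
noncritical points of the spectrum. -/
def nonresonantDomain (a ω : ℝ) (l m : ℕ → ℝ) (k : ℂ → ℂ) : Set ℂ :=
  upperHalf ∪ (fun t : ℝ => (t : ℂ)) '' regularSpectrum a ω l m k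

theorem nonresonantDomain_subset_blochDomain (a ω : ℝ) (l m : ℕ → ℝ) (k : ℂ → ℂ) :
    nonresonantDomain a ω l m k ⊆ blochDomain l m :=
  union_subset_union_right _ (image_mono sdiff_subset)

theorem IsQuasiMomentum.im_nonneg (hk : IsQuasiMomentum q a l m k) {z : ℂ}
    (hz : z ∈ blochDomain l m) : 0 ≤ (k z).im := by
  rcases hz with hz | ⟨t, ht, rfl⟩
  · exact (hk.maps_upper z hz).le
  · exact (hk.real_on_spectrum t ht.1).ge

/-- At a noncritical point of the spectrum `k ± a ω` is not a multiple of `π`. -/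
theorem ne_int_mul_pi_of_mem_regularSpectrum (hk : IsQuasiMomentum q a l m k)
    (hl : IsEigenvalueSequence q a 1 l) (hψ : IsBlochPair q a l m k ψp ψp' ψm ψm') (ha : 0 < a)
    {ω : ℝ} (hω : ∀ j : ℤ, 2 * a * ω / Real.pi ≠ j) {t : ℝ}
    (ht : t ∈ regularSpectrum a ω l m k) (j : ℤ) :
    (k t).re + a * ω ≠ j * Real.pi ∧ (k t).re - a * ω ≠ j * Real.pi := by
  have hpi := Real.pi_pos
  have hre := hk.re_nonneg hl hψ ha ht.1.1
  have hkt : k t = ((k t).re : ℝ) :=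
    Complex.ext (by simp) (by simpa using hk.real_on_spectrum t ht.1.1)
  set r := (k t).re
  set F := Int.fract (a * ω / Real.pi) with hF
  set N := ⌊a * ω / Real.pi⌋ with hN
  have hFN : a * ω = (N + F) * Real.pi := by
    rw [hF, hN, Int.floor_add_fract]
    field_simp
  have hF0 : 0 < F := by
    refine lt_of_le_of_ne (Int.fract_nonneg _) fun h0 => hω (2 * N) ?_
    rw [mul_assoc, hFN, ← h0]
    push_cast
    field_simp
    ring
  have hF1 : F < 1 := Int.fract_lt_one _
  have hnot : ¬ ∃ n : ℕ, k t = (Real.pi * (n + 1 - F) : ℝ) ∨ k t = (Real.pi * (n + F) : ℝ) :=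
    fun h => ht.2 ⟨ht.1.1, h⟩
  constructor
  · intro h
    have hr : r = Real.pi * ((j - N : ℤ) - F) := by push_cast; linarith
    have h1 : (0 : ℝ) < ((j - N : ℤ) : ℝ) := by
      have : 0 ≤ ((j - N : ℤ) - F : ℝ) := by
        rw [hr] at hre
        exact nonneg_of_mul_nonneg_right hre hpi
      linarith
    have h2 : 0 < j - N := by exact_mod_cast h1
    refine hnot ⟨(j - N - 1).toNat, Or.inl ?_⟩
    have h3 : (((j - N - 1).toNat : ℕ) : ℝ) = ((j - N - 1 : ℤ) : ℝ) := by
      exact_mod_cast Int.toNat_of_nonneg (by omega)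
    rw [hkt, hr, h3]
    push_cast
    ring
  · intro h
    have hr : r = Real.pi * ((j + N : ℤ) + F) := by push_cast; linarith
    have h1 : (-1 : ℝ) < ((j + N : ℤ) : ℝ) := by
      have : 0 ≤ ((j + N : ℤ) + F : ℝ) := by
        rw [hr] at hre
        exact nonneg_of_mul_nonneg_right hre hpi
      linarith
    have h2 : -1 < j + N := by exact_mod_cast h1
    refine hnot ⟨(j + N).toNat, Or.inr ?_⟩
    have h3 : (((j + N).toNat : ℕ) : ℝ) = ((j + N : ℤ) : ℝ) := by
      exact_mod_cast Int.toNat_of_nonneg (by omega)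
    rw [hkt, hr, h3]

/-- The multipliers of `ψ₊ ψ₋`, `ψ₊²` and `ψ₋²` times `exp (± 2 i ω x)` are different from `1`. -/
theorem multiplier_ne_one (hk : IsQuasiMomentum q a l m k)
    (hl : IsEigenvalueSequence q a 1 l) (hψ : IsBlochPair q a l m k ψp ψp' ψm ψm') (ha : 0 < a)
    {ω : ℝ} (hω : ∀ j : ℤ, 2 * a * ω / Real.pi ≠ j) {z : ℂ}
    (hz : z ∈ nonresonantDomain a ω l m k) {ρ : ℂ} (hρ : ρ = 1 ∨
      ρ = Complex.exp (Complex.I * k z) ^ 2 ∨ ρ = Complex.exp (-(Complex.I * k z)) ^ 2) :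
    ρ * Complex.exp (2 * ω * a * Complex.I) ≠ 1 ∧
      ρ * Complex.exp (-(2 * ω * a * Complex.I)) ≠ 1 := by
  have hpi := Real.pi_pos
  -- in all cases the product is an exponential `exp (2 i (s k ± ω a))`, `s ∈ {0, 1, -1}`
  obtain ⟨s, hs, hρs⟩ : ∃ s : ℝ, (s = 0 ∨ s = 1 ∨ s = -1) ∧
      ρ = Complex.exp (2 * s * k z * Complex.I) := by
    rcases hρ with rfl | rfl | rfl
    · exact ⟨0, by simp, by simp⟩
    · refine ⟨1, by simp, ?_⟩
      rw [← Complex.exp_nat_mul]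
      congr 1
      push_cast
      ring
    · refine ⟨-1, by simp, ?_⟩
      rw [← Complex.exp_nat_mul]
      congr 1
      push_cast
      ring
  have key : ∀ η : ℝ, (η = 1 ∨ η = -1) →
      Complex.exp (2 * s * k z * Complex.I + η * (2 * ω * a * Complex.I)) ≠ 1 := by
    intro η hη h1
    obtain ⟨n, hn⟩ := Complex.exp_eq_one_iff.1 h1
    have hre := congrArg Complex.re hn
    have him := congrArg Complex.im hn
    simp at hre him
    rcases hs with rfl | rfl | rfl
    · rcases hη with rfl | rfl
      · refine hω (2 * n) ?_
        push_cast
        field_simp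
        linarith
      · refine hω (-(2 * n)) ?_
        push_cast
        field_simp
        linarith
    all_goals
      rcases hz with hz | ⟨t, ht, rfl⟩
      · have := hk.maps_upper z hz
        rcases hre with hre | hre <;> linarith
      · obtain ⟨g1, g2⟩ := ne_int_mul_pi_of_mem_regularSpectrum hk hl hψ ha hω ht n
        obtain ⟨g3, g4⟩ := ne_int_mul_pi_of_mem_regularSpectrum hk hl hψ ha hω ht (-n)
        rcases hη with rfl | rfl
        all_goals
          first
          | exact g1 (by linarith)
          | exact g2 (by linarith)
          | exact g3 (by push_cast; linarith)
          | exact g4 (by push_cast; linarith)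
  have h1 := key 1 (by simp)
  have h2 := key (-1) (by simp)
  rw [hρs, ← Complex.exp_add, ← Complex.exp_add]
  constructor
  · simpa using h1
  · simpa using h2

end Bloch

/-! ### The amplitudes of a solution with respect to the Bloch solutions -/

section Amplitudes

variable {q q₁ : ℝ → ℝ} {a c ω δ γ : ℝ} {l m : ℕ → ℝ} {k : ℂ → ℂ}
  {ψp ψp' ψm ψm' φ φ' : ℝ → ℂ → ℂ}

/-- A nonvanishing continuous function is locally bounded away from `0`. -/
theorem exists_pos_eventually_le_norm {Ω : Set ℂ} {f : ℂ → ℂ} {z : ℂ}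
    (hf : ContinuousWithinAt f Ω z) (h : f z ≠ 0) :
    ∃ d : ℝ, 0 < d ∧ ∀ᶠ w in 𝓝[Ω] z, d ≤ ‖f w‖ := by
  have h0 : 0 < ‖f z‖ := norm_pos_iff.2 h
  exact ⟨‖f z‖ / 2, by positivity,
    hf.norm.eventually (Ici_mem_nhds (by linarith))⟩

/-- The quadratic expressions in the Bloch solutions are not in resonance with `sin (2 ω x + δ)`,
with constants that are locally uniform in the spectral parameter. -/
theorem IsBlochPair.eventually_isNonresonant (hψ : IsBlochPair q a l m k ψp ψp' ψm ψm')
    (ha : 0 < a) (hq : ∀ x, 0 ≤ x → IntervalIntegrable q volume 0 x)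
    (hk : IsQuasiMomentum q a l m k) (hl : IsEigenvalueSequence q a 1 l)
    (hω : ∀ j : ℤ, 2 * a * ω / Real.pi ≠ j) (δ : ℝ) {z₀ : ℂ}
    (hz₀ : z₀ ∈ nonresonantDomain a ω l m k) :
    ∃ K : ℝ, 0 ≤ K ∧ ∀ᶠ z in 𝓝[nonresonantDomain a ω l m k] z₀, ∃ GP GR GS : ℝ → ℂ,
      IsNonresonant (fun x => Real.sin (2 * ω * x + δ)) K 0
        (fun x => ψp x z * ψm x z / blochWronskian ψp ψp' ψm ψm' z) GP ∧
      IsNonresonant (fun x => Real.sin (2 * ω * x + δ)) K (-(2 * (k z).im / a))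
        (fun x => ψp x z ^ 2 / blochWronskian ψp ψp' ψm ψm' z) GR ∧
      IsNonresonant (fun x => Real.sin (2 * ω * x + δ)) K (2 * (k z).im / a)
        (fun x => ψm x z ^ 2 / blochWronskian ψp ψp' ψm ψm' z) GS := by
  set Ω := nonresonantDomain a ω l m k with hΩ
  set W := blochWronskian ψp ψp' ψm ψm' with hW
  have hsub : Ω ⊆ blochDomain l m := nonresonantDomain_subset_blochDomain a ω l m k
  have hkc : ContinuousWithinAt k Ω z₀ :=
    hk.continuousOn.mono (hsub.trans (blochDomain_subset_closedUpperHalf l m)) z₀ hz₀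
  obtain ⟨K₀, hK₀, hbd⟩ := hψ.eventually_bounded ha hq (hsub hz₀)
  have hbd := hbd.filter_mono (nhdsWithin_mono z₀ hsub)
  obtain ⟨w, hw, hWle⟩ := exists_pos_eventually_le_norm
    (hψ.continuous_wronskian.mono hsub z₀ hz₀) (hψ.wronskian_ne_zero z₀ (hsub hz₀))
  -- one lower bound for the distances of all the multipliers to `1`
  have hmult : ∀ ρ : ℂ → ℂ, ContinuousWithinAt ρ Ω z₀ →
      (ρ z₀ = 1 ∨ ρ z₀ = Complex.exp (Complex.I * k z₀) ^ 2 ∨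
        ρ z₀ = Complex.exp (-(Complex.I * k z₀)) ^ 2) →
      ∃ d : ℝ, 0 < d ∧ ∀ᶠ z in 𝓝[Ω] z₀, d ≤ ‖ρ z * Complex.exp (2 * ω * a * Complex.I) - 1‖ ∧
        d ≤ ‖ρ z * Complex.exp (-(2 * ω * a * Complex.I)) - 1‖ := by
    intro ρ hρc hρ
    obtain ⟨h1, h2⟩ := multiplier_ne_one hk hl hψ ha hω hz₀ hρ
    obtain ⟨d₁, hd₁, he₁⟩ := exists_pos_eventually_le_norm
      ((hρc.mul_const (Complex.exp (2 * ω * a * Complex.I))).sub_const 1) (sub_ne_zero.2 h1)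
    obtain ⟨d₂, hd₂, he₂⟩ := exists_pos_eventually_le_norm
      ((hρc.mul_const (Complex.exp (-(2 * ω * a * Complex.I)))).sub_const 1) (sub_ne_zero.2 h2)
    refine ⟨min d₁ d₂, lt_min hd₁ hd₂, ?_⟩
    filter_upwards [he₁, he₂] with z e1 e2
    exact ⟨(min_le_left _ _).trans e1, (min_le_right _ _).trans e2⟩
  have hIk : ContinuousWithinAt (fun z => Complex.I * k z) Ω z₀ := hkc.const_mul _
  obtain ⟨d₀, hd₀, he₀⟩ := hmult (fun _ => 1) continuousWithinAt_const (Or.inl rfl)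
  obtain ⟨d₁, hd₁, he₁⟩ := hmult (fun z => Complex.exp (Complex.I * k z) ^ 2)
    ((Complex.continuous_exp.continuousAt.comp_continuousWithinAt hIk).pow 2) (Or.inr (Or.inl rfl))
  obtain ⟨d₂, hd₂, he₂⟩ := hmult (fun z => Complex.exp (-(Complex.I * k z)) ^ 2)
    ((Complex.continuous_exp.continuousAt.comp_continuousWithinAt hIk.neg).pow 2)
    (Or.inr (Or.inr rfl))
  set L := (k z₀).im + 1 with hL
  have hLev : ∀ᶠ z in 𝓝[Ω] z₀, (k z).im < L :=
    (Complex.continuous_im.continuousAt.comp_continuousWithinAt hkc).eventually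
      (Iio_mem_nhds (lt_add_one _))
  set C : ℝ → ℝ := fun d => K₀ * K₀ / w * (1 + a * (1 + 1 / d)) * Real.exp (2 * L) with hC
  have hC0 : ∀ d, 0 < d → 0 ≤ C d := fun d hd => by simp only [hC]; positivity
  have c0 := hC0 d₀ hd₀
  have c1 := hC0 d₁ hd₁
  have c2 := hC0 d₂ hd₂
  refine ⟨C d₀ + C d₁ + C d₂, by positivity, ?_⟩
  filter_upwards [hbd, hWle, he₀, he₁, he₂, hLev, self_mem_nhdsWithin] with
    z hb hWz e0 e1 e2 hLz hz
  have hz' := hsub hz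
  have him := hk.im_nonneg hz'
  have hsp := (hψ.sol_plus z hz').isACPrimitive hq
  have hsm := (hψ.sol_minus z hz').isACPrimitive hq
  have hWz' : w ≤ ‖W z‖ := hWz
  have hquot : ∀ u v : ℂ, ‖u‖ ≤ K₀ → ‖v‖ ≤ K₀ → ‖u * v / W z‖ ≤ K₀ * K₀ / w := by
    intro u v hu hv
    rw [norm_div, norm_mul]
    exact div_le_div₀ (by positivity) (mul_le_mul hu hv (norm_nonneg _) hK₀) hw hWz'
  have hbp : ∀ x ∈ Icc 0 a, ‖ψp x z‖ ≤ K₀ := fun x hx =>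
    (le_add_of_nonneg_right (norm_nonneg _)).trans (hb x hx).1
  have hbm : ∀ x ∈ Icc 0 a, ‖ψm x z‖ ≤ K₀ := fun x hx =>
    (le_add_of_nonneg_right (norm_nonneg _)).trans (hb x hx).2
  have hexpL : ∀ κ : ℝ, |κ| * a ≤ 2 * (k z).im → ∀ d, 0 < d →
      K₀ * K₀ / w * (1 + a * (1 + 1 / d)) * Real.exp (|κ| * a) ≤ C d := by
    intro κ hκ d hd
    refine mul_le_mul_of_nonneg_left (Real.exp_le_exp.2 (by linarith)) (by positivity)
  have hκa : 2 * (k z).im / a * a = 2 * (k z).im := by field_simp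
  have hκ0 : 0 ≤ 2 * (k z).im / a := by positivity
  have hqp := hψ.quasiperiodic_plus z hz'
  have hqm := hψ.quasiperiodic_minus z hz'
  have hinv : Complex.exp (Complex.I * k z) * Complex.exp (-(Complex.I * k z)) = 1 := by
    rw [← Complex.exp_add, add_neg_cancel, Complex.exp_zero]
  obtain ⟨GP, hGP⟩ := exists_isNonresonant_sin (κ := 0) (ω := ω) (δ := δ) (ρ := 1) ha
    (P := fun x => ψp x z * ψm x z / W z)
    ((hsp.1.continuousOn.mul hsm.1.continuousOn).div_const _)
    (fun x hx => by
      rw [hqp x hx, hqm x hx, one_mul]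
      congr 1
      linear_combination (ψp x z * ψm x z) * hinv)
    (by simp) (fun x hx => hquot _ _ (hbp x hx) (hbm x hx)) hd₀ e0.1 e0.2
  obtain ⟨GR, hGR⟩ := exists_isNonresonant_sin (κ := -(2 * (k z).im / a)) (ω := ω) (δ := δ) ha
    (P := fun x => ψp x z ^ 2 / W z) ((hsp.1.continuousOn.pow 2).div_const _)
    (fun x hx => by
      rw [hqp x hx]
      ring)
    (by
      rw [norm_pow, Complex.norm_exp, ← Real.exp_nat_mul, neg_mul, hκa]
      congr 1
      simp)
    (fun x hx => by rw [pow_two]; exact hquot _ _ (hbp x hx) (hbp x hx)) hd₁ e1.1 e1.2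
  obtain ⟨GS, hGS⟩ := exists_isNonresonant_sin (κ := 2 * (k z).im / a) (ω := ω) (δ := δ) ha
    (P := fun x => ψm x z ^ 2 / W z) ((hsm.1.continuousOn.pow 2).div_const _)
    (fun x hx => by
      rw [hqm x hx]
      ring)
    (by
      rw [norm_pow, Complex.norm_exp, ← Real.exp_nat_mul, hκa]
      congr 1
      simp)
    (fun x hx => by rw [pow_two]; exact hquot _ _ (hbm x hx) (hbm x hx)) hd₂ e2.1 e2.2
  refine ⟨GP, GR, GS, hGP.mono ?_, hGR.mono ?_, hGS.mono ?_⟩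
  · have := hexpL 0 (by simpa using him) d₀ hd₀
    linarith
  · have := hexpL (-(2 * (k z).im / a)) (by rw [abs_neg, abs_of_nonneg hκ0, hκa]) d₁ hd₁
    linarith
  · have := hexpL (2 * (k z).im / a) (by rw [abs_of_nonneg hκ0, hκa]) d₂ hd₂
    linarith

/-- The amplitude `A` in the representation `φ = A ψ₋ + B ψ₊`, `φ' = A ψ₋' + B ψ₊'`. -/
noncomputable def amplitudeMinus (ψp ψp' ψm ψm' φ φ' : ℝ → ℂ → ℂ) (x : ℝ) (z : ℂ) : ℂ :=
  (φ x z * ψp' x z - φ' x z * ψp x z) / blochWronskian ψp ψp' ψm ψm' z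

/-- The amplitude `B` in the representation `φ = A ψ₋ + B ψ₊`, `φ' = A ψ₋' + B ψ₊'`. -/
noncomputable def amplitudePlus (ψp ψp' ψm ψm' φ φ' : ℝ → ℂ → ℂ) (x : ℝ) (z : ℂ) : ℂ :=
  (φ' x z * ψm x z - φ x z * ψm' x z) / blochWronskian ψp ψp' ψm ψm' z

theorem IsBlochPair.amplitude_representation (hψ : IsBlochPair q a l m k ψp ψp' ψm ψm')
    (hq : ∀ x, 0 ≤ x → IntervalIntegrable q volume 0 x) (φ φ' : ℝ → ℂ → ℂ) {z : ℂ}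
    (hz : z ∈ blochDomain l m) {x : ℝ} (hx : 0 ≤ x) :
    φ x z = amplitudeMinus ψp ψp' ψm ψm' φ φ' x z * ψm x z +
      amplitudePlus ψp ψp' ψm ψm' φ φ' x z * ψp x z ∧
    φ' x z = amplitudeMinus ψp ψp' ψm ψm' φ φ' x z * ψm' x z +
      amplitudePlus ψp ψp' ψm ψm' φ φ' x z * ψp' x z := by
  have hW : ψp' x z * ψm x z - ψp x z * ψm' x z = blochWronskian ψp ψp' ψm ψm' z :=
    (hψ.sol_plus z hz).wronskian_eq (hψ.sol_minus z hz) hq hx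
  have hne : blochWronskian ψp ψp' ψm ψm' z ≠ 0 := hψ.wronskian_ne_zero z hz
  unfold amplitudeMinus amplitudePlus
  constructor
  · field_simp
    rw [← hW]
    ring
  · field_simp
    rw [← hW]
    ring

/-- Variation of parameters: the system for the amplitudes. -/
theorem IsBlochPair.amplitude_system (hψ : IsBlochPair q a l m k ψp ψp' ψm ψm')
    (hq : ∀ x, 0 ≤ x → IntervalIntegrable q volume 0 x) (hq₁ : IntegrableOn q₁ (Ioi 0)) {z : ℂ}
    (hφ : IsSchrodingerSolution (perturbedPotential q q₁ c ω δ γ) z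
      (fun x => φ x z) (fun x => φ' x z)) (hz : z ∈ blochDomain l m) :
    IsACPrimitive (fun x => amplitudeMinus ψp ψp' ψm ψm' φ φ' x z)
      (fun x => -((c / (x + 1) ^ γ * Real.sin (2 * ω * x + δ) + q₁ x : ℝ) *
        (ψp x z * ψm x z / blochWronskian ψp ψp' ψm ψm' z *
            amplitudeMinus ψp ψp' ψm ψm' φ φ' x z +
          ψp x z ^ 2 / blochWronskian ψp ψp' ψm ψm' z *
            amplitudePlus ψp ψp' ψm ψm' φ φ' x z))) ∧
    IsACPrimitive (fun x => amplitudePlus ψp ψp' ψm ψm' φ φ' x z)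
      (fun x => (c / (x + 1) ^ γ * Real.sin (2 * ω * x + δ) + q₁ x : ℝ) *
        (ψm x z ^ 2 / blochWronskian ψp ψp' ψm ψm' z *
            amplitudeMinus ψp ψp' ψm ψm' φ φ' x z +
          ψp x z * ψm x z / blochWronskian ψp ψp' ψm ψm' z *
            amplitudePlus ψp ψp' ψm ψm' φ φ' x z)) := by
  have hs := hφ.isACPrimitive fun x hx => intervalIntegrable_perturbedPotential hq hq₁ hx
  have hp := (hψ.sol_plus z hz).isACPrimitive hq
  have hm := (hψ.sol_minus z hz).isACPrimitive hq
  have hpot : ∀ x : ℝ, perturbedPotential q q₁ c ω δ γ x =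
      q x + (c / (x + 1) ^ γ * Real.sin (2 * ω * x + δ) + q₁ x) := fun x => by
    unfold perturbedPotential
    ring
  have hrep := fun x (hx : 0 ≤ x) => (hψ.amplitude_representation hq φ φ' hz hx).1
  set W := blochWronskian ψp ψp' ψm ψm' z with hW
  constructor
  · refine (((hs.1.mul hp.2).sub (hs.2.mul hp.1)).const_mul W⁻¹).congr
      (fun x _ => by unfold amplitudeMinus; rw [div_eq_inv_mul]) (fun x hx => ?_)
    rw [hpot x]
    generalize c / (x + 1) ^ γ * Real.sin (2 * ω * x + δ) + q₁ x = Q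
    push_cast
    calc _ = -(W⁻¹ * (Q * ψp x z * (amplitudeMinus ψp ψp' ψm ψm' φ φ' x z * ψm x z +
            amplitudePlus ψp ψp' ψm ψm' φ φ' x z * ψp x z))) := by ring
      _ = _ := by rw [← hrep x hx]; ring
  · refine (((hs.2.mul hm.1).sub (hs.1.mul hm.2)).const_mul W⁻¹).congr
      (fun x _ => by unfold amplitudePlus; rw [div_eq_inv_mul]) (fun x hx => ?_)
    rw [hpot x]
    generalize c / (x + 1) ^ γ * Real.sin (2 * ω * x + δ) + q₁ x = Q
    push_cast
    calc _ = W⁻¹ * (Q * ψm x z * (amplitudeMinus ψp ψp' ψm ψm' φ φ' x z * ψm x z +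
            amplitudePlus ψp ψp' ψm ψm' φ φ' x z * ψp x z)) := by ring
      _ = _ := by rw [← hrep x hx]; ring

/-- The amplitudes converge, locally uniformly in the spectral parameter (in a weighted sense for
the amplitude of the decaying Bloch solution). -/
theorem IsBlochPair.amplitude_locally_uniform (hψ : IsBlochPair q a l m k ψp ψp' ψm ψm')
    (ha : 0 < a) (hq : ∀ x, 0 ≤ x → IntervalIntegrable q volume 0 x)
    (hq₁ : IntegrableOn q₁ (Ioi 0)) (hγ : 1 / 2 < γ)
    (hk : IsQuasiMomentum q a l m k) (hl : IsEigenvalueSequence q a 1 l)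
    (hω : ∀ j : ℤ, 2 * a * ω / Real.pi ≠ j)
    (hφ : ∀ z, IsSchrodingerSolution (perturbedPotential q q₁ c ω δ γ) z
      (fun x => φ x z) (fun x => φ' x z))
    (hAc : ∀ x, 0 ≤ x → ContinuousOn (amplitudeMinus ψp ψp' ψm ψm' φ φ' x) (blochDomain l m))
    (hBc : ∀ x, 0 ≤ x → ContinuousOn (amplitudePlus ψp ψp' ψm ψm' φ φ' x) (blochDomain l m))
    {z₀ : ℂ} (hz₀ : z₀ ∈ nonresonantDomain a ω l m k) :
    ∃ X₀ : ℝ, 0 ≤ X₀ ∧ ∃ τ : ℝ → ℝ, Tendsto τ atTop (𝓝 0) ∧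
      ∀ᶠ z in 𝓝[nonresonantDomain a ω l m k] z₀, ∀ x y : ℝ, X₀ ≤ x → x ≤ y →
        ‖amplitudeMinus ψp ψp' ψm ψm' φ φ' y z - amplitudeMinus ψp ψp' ψm ψm' φ φ' x z‖ ≤ τ x ∧
        Real.exp (-(2 * (k z).im / a) * y) * ‖amplitudePlus ψp ψp' ψm ψm' φ φ' y z -
          amplitudePlus ψp ψp' ψm ψm' φ φ' x z‖ ≤ τ x := by
  have hsub := nonresonantDomain_subset_blochDomain a ω l m k
  obtain ⟨K, hK, hnon⟩ := hψ.eventually_isNonresonant ha hq hk hl hω δ hz₀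
  obtain ⟨X₀, hX₀, τ, hτ, hmain⟩ := amplitude_asymptotics (isSlowlyDecaying_rpow c hγ)
    (fun x => Real.abs_sin_le_one (2 * ω * x + δ)) hq₁ hK
  set M := ‖amplitudeMinus ψp ψp' ψm ψm' φ φ' X₀ z₀‖ +
    ‖amplitudePlus ψp ψp' ψm ψm' φ φ' X₀ z₀‖ + 1 with hM
  have hMc := ((hAc X₀ hX₀).mono hsub z₀ hz₀).norm.add ((hBc X₀ hX₀).mono hsub z₀ hz₀).norm
  have hMev := hMc.eventually (Iio_mem_nhds (lt_add_one _))
  refine ⟨X₀, hX₀, fun x => M * τ x, by simpa using hτ.const_mul M, ?_⟩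
  filter_upwards [hnon, hMev, self_mem_nhdsWithin] with z hn hMz hz x y hx hxy
  obtain ⟨GP, GR, GS, hP, hR, hS⟩ := hn
  have him := hk.im_nonneg (hsub hz)
  have hκ : 0 ≤ 2 * (k z).im / a := by positivity
  obtain ⟨hA, hB⟩ := hψ.amplitude_system hq hq₁ (hφ z) (hsub hz)
  refine hmain _ _ GP _ GR _ GS _ _ hP hR hS hA hB M ?_ x y hx hxy hκ
  have h1 : Real.exp (-(2 * (k z).im / a) * X₀) ≤ 1 := by
    rw [Real.exp_le_one_iff]
    nlinarith
  have h2 := mul_le_of_le_one_left (norm_nonneg (amplitudePlus ψp ψp' ψm ψm' φ φ' X₀ z)) h1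
  have h3 : ‖amplitudeMinus ψp ψp' ψm ψm' φ φ' X₀ z‖ +
    ‖amplitudePlus ψp ψp' ψm ψm' φ φ' X₀ z‖ < M := hMz
  linarith

end Amplitudes

/-! ### The limits of the amplitudes -/

section Limits

variable {q q₁ : ℝ → ℝ} {a c ω δ γ : ℝ} {l m : ℕ → ℝ} {k : ℂ → ℂ}
  {ψp ψp' ψm ψm' φ φ' : ℝ → ℂ → ℂ}

theorem IsBlochPair.amplitude_regular (hψ : IsBlochPair q a l m k ψp ψp' ψm ψm')
    (hq : ∀ x, 0 ≤ x → IntervalIntegrable q volume 0 x) {V : ℝ → ℝ} {p p' : ℂ}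
    (hV : ∀ x, 0 ≤ x → IntervalIntegrable V volume 0 x)
    (hφ : IsFixedDataFamily V univ p p' φ φ') {x : ℝ} (hx : 0 ≤ x) :
    ContinuousOn (amplitudeMinus ψp ψp' ψm ψm' φ φ' x) (blochDomain l m) ∧
    ContinuousOn (amplitudePlus ψp ψp' ψm ψm' φ φ' x) (blochDomain l m) ∧
    DifferentiableOn ℂ (amplitudeMinus ψp ψp' ψm ψm' φ φ' x) upperHalf := by
  have hc := hφ.continuousOn hV hx
  have hcp := hc.1.mono (subset_univ (blochDomain l m))
  have hcp' := hc.2.mono (subset_univ (blochDomain l m))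
  have hd := hψ.continuousOn_deriv hq hx
  refine ⟨((hcp.mul hd.1).sub (hcp'.mul (hψ.continuous_plus x hx))).div
      hψ.continuous_wronskian hψ.wronskian_ne_zero,
    ((hcp'.mul (hψ.continuous_minus x hx)).sub (hcp.mul hd.2)).div
      hψ.continuous_wronskian hψ.wronskian_ne_zero, fun z hz => ?_⟩
  have hφd := hφ.differentiableAt hV hx (z := z) univ_mem
  exact (((hφd.1.mul (hψ.differentiableAt_deriv hq hx hz).1).sub
    (hφd.2.mul (hψ.analytic_plus x hx z hz).differentiableAt)).div
    (hψ.analytic_wronskian z hz).differentiableAt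
    (hψ.wronskian_ne_zero z (upperHalf_subset_blochDomain l m hz))).differentiableWithinAt

/-- A function on the half-line whose increments beyond `x` are bounded by `τ x → 0` converges, and
its distance to the limit is bounded by `τ`. -/
theorem exists_limit_of_increments {F : ℝ → ℂ} {τ : ℝ → ℝ} {X₀ : ℝ} (hτ : Tendsto τ atTop (𝓝 0))
    (h : ∀ x y : ℝ, X₀ ≤ x → x ≤ y → ‖F y - F x‖ ≤ τ x) :
    ∃ b : ℂ, Tendsto F atTop (𝓝 b) ∧ ∀ x, X₀ ≤ x → ‖b - F x‖ ≤ τ x := by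
  have hc : Cauchy (map F atTop) := by
    refine Metric.cauchy_iff.2 ⟨inferInstance, fun ε hε => ?_⟩
    obtain ⟨x, hx1, hx2⟩ := ((hτ.eventually (Iio_mem_nhds (half_pos hε))).and
      (eventually_ge_atTop X₀)).exists
    refine ⟨F '' Ici x, image_mem_map (Ici_mem_atTop x), ?_⟩
    rintro _ ⟨y, hy, rfl⟩ _ ⟨w, hw, rfl⟩
    have h1 := h x y hx2 hy
    have h2 := h x w hx2 hw
    have h3 : τ x < ε / 2 := hx1
    rw [dist_eq_norm]
    calc ‖F y - F w‖ = ‖(F y - F x) - (F w - F x)‖ := by congr 1; ring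
      _ ≤ ‖F y - F x‖ + ‖F w - F x‖ := norm_sub_le _ _
      _ < ε := by linarith
  obtain ⟨b, hb⟩ := cauchy_map_iff_exists_tendsto.1 hc
  refine ⟨b, hb, fun x hx => ?_⟩
  refine le_of_tendsto (hb.sub_const (F x)).norm ?_
  filter_upwards [eventually_ge_atTop x] with y hy
  exact h x y hx hy

/-- With an exponential weight that decays, the weighted function tends to `0`. -/
theorem tendsto_zero_of_weighted_increments {F : ℝ → ℂ} {τ : ℝ → ℝ} {X₀ κ : ℝ} (hκ : 0 < κ)
    (hτ : Tendsto τ atTop (𝓝 0))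
    (h : ∀ x y : ℝ, X₀ ≤ x → x ≤ y → Real.exp (-κ * y) * ‖F y - F x‖ ≤ τ x) :
    Tendsto (fun x => Real.exp (-κ * x) * ‖F x‖) atTop (𝓝 0) := by
  refine Metric.tendsto_atTop.2 fun ε hε => ?_
  obtain ⟨x, hx1, hx2⟩ := ((hτ.eventually (Iio_mem_nhds (half_pos hε))).and
    (eventually_ge_atTop X₀)).exists
  have hexp : Tendsto (fun y : ℝ => Real.exp (-κ * y) * ‖F x‖) atTop (𝓝 0) := by
    have h1 : Tendsto (fun y : ℝ => -κ * y) atTop atBot :=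
      tendsto_id.const_mul_atTop_of_neg (by linarith)
    simpa using (Real.tendsto_exp_atBot.comp h1).mul_const ‖F x‖
  obtain ⟨Y, hY⟩ := eventually_atTop.1 ((hexp.eventually (Iio_mem_nhds (half_pos hε))).and
    (eventually_ge_atTop x))
  refine ⟨Y, fun y hy => ?_⟩
  obtain ⟨h2, h3⟩ := hY y hy
  have h2' : Real.exp (-κ * y) * ‖F x‖ < ε / 2 := h2
  have h1' : τ x < ε / 2 := hx1
  have h4 := h x y hx2 h3
  have h5 : ‖F y‖ ≤ ‖F x‖ + ‖F y - F x‖ := norm_le_norm_add_norm_sub' _ _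
  have h6 := mul_le_mul_of_nonneg_left h5 (Real.exp_pos (-κ * y)).le
  rw [dist_zero_right, Real.norm_eq_abs, abs_of_nonneg (by positivity)]
  linarith

/-- The common form of the asymptotics: `F = A u + B v` with `A → A∞`, and `B v` replaced by
`(B - B∞) v` with `exp (-2 κ x) (B - B∞) → 0`. -/
theorem isLittleO_of_amplitudes {κ K : ℝ} {A B u v F : ℝ → ℂ} {A₀ B₀ : ℂ}
    (hF : ∀ x, 0 ≤ x → F x = A x * u x + B x * v x)
    (hu : ∀ x, 0 ≤ x → ‖u x‖ ≤ K * Real.exp (κ * x))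
    (hv : ∀ x, 0 ≤ x → ‖v x‖ ≤ K * Real.exp (-κ * x))
    (hA : Tendsto A atTop (𝓝 A₀))
    (hB : Tendsto (fun x => Real.exp (-(2 * κ) * x) * ‖B x - B₀‖) atTop (𝓝 0)) :
    (fun x => F x - (A₀ * u x + B₀ * v x)) =o[atTop] (fun x : ℝ => Real.exp (κ * x)) := by
  have h1 : (fun x => (A x - A₀) * u x) =o[atTop] (fun x : ℝ => (1 : ℝ) * Real.exp (κ * x)) := by
    refine IsLittleO.mul_isBigO ?_ (IsBigO.of_bound K ?_)
    · rw [isLittleO_one_iff]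
      simpa using hA.sub_const A₀
    · filter_upwards [eventually_ge_atTop (0 : ℝ)] with x hx
      rw [Real.norm_eq_abs, abs_of_pos (Real.exp_pos _)]
      exact hu x hx
  have h2 : (fun x => (B x - B₀) * v x) =o[atTop] (fun x : ℝ => (1 : ℝ) * Real.exp (κ * x)) := by
    have h3 : (fun x => (B x - B₀) * v x) =
        fun x => ((Real.exp (-(2 * κ) * x) : ℝ) * (B x - B₀)) *
          ((Real.exp (2 * κ * x) : ℝ) * v x) := by
      funext x
      have : ((Real.exp (-(2 * κ) * x) : ℝ) : ℂ) * (Real.exp (2 * κ * x) : ℝ) = 1 := by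
        rw [← Complex.ofReal_mul, ← Real.exp_add]
        simp
      linear_combination (-(B x - B₀) * v x) * this
    rw [h3]
    refine IsLittleO.mul_isBigO ?_ (IsBigO.of_bound K ?_)
    · rw [isLittleO_one_iff]
      refine tendsto_zero_iff_norm_tendsto_zero.2 (hB.congr fun x => ?_)
      rw [norm_mul, Complex.norm_real, Real.norm_eq_abs, abs_of_pos (Real.exp_pos _)]
    · filter_upwards [eventually_ge_atTop (0 : ℝ)] with x hx
      rw [norm_mul, Complex.norm_real, Real.norm_eq_abs, abs_of_pos (Real.exp_pos _),
        Real.norm_eq_abs, abs_of_pos (Real.exp_pos _)]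
      have h4 := mul_le_mul_of_nonneg_left (hv x hx) (Real.exp_pos (2 * κ * x)).le
      refine h4.trans (le_of_eq ?_)
      rw [mul_left_comm, ← Real.exp_add]
      ring_nf
  have h3 := h1.add h2
  simp only [one_mul] at h3
  refine h3.congr' ?_ EventuallyEq.rfl
  filter_upwards [eventually_ge_atTop (0 : ℝ)] with x hx
  rw [hF x hx]
  ring

/-- On the spectrum the amplitudes of a real solution are complex conjugates of each other. -/
theorem IsBlochPair.amplitudePlus_eq_conj (hψ : IsBlochPair q a l m k ψp ψp' ψm ψm')
    {V : ℝ → ℝ} (hV : ∀ x, 0 ≤ x → IntervalIntegrable V volume 0 x) {t p p' : ℝ}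
    (hφ : IsSchrodingerSolution V t (fun x => φ x t) (fun x => φ' x t))
    (hp : φ 0 t = p) (hp' : φ' 0 t = p') (ht : t ∈ bandInterior l m) {x : ℝ} (hx : 0 ≤ x) :
    amplitudePlus ψp ψp' ψm ψm' φ φ' x t =
      (starRingEnd ℂ) (amplitudeMinus ψp ψp' ψm ψm' φ φ' x t) := by
  have htD : (t : ℂ) ∈ blochDomain l m := Or.inr ⟨t, ht, rfl⟩
  have hconj : ∀ f f' : ℝ → ℂ, ∀ x : ℝ, HasDerivWithinAt f (f' x) (Ici 0) x →
      HasDerivWithinAt (fun x => (starRingEnd ℂ) (f x)) ((starRingEnd ℂ) (f' x)) (Ici 0) x :=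
    fun f f' x h => h.star
  have hφc : IsSchrodingerSolution V t (fun x => (starRingEnd ℂ) (φ x t))
      (fun x => (starRingEnd ℂ) (φ' x t)) := by
    refine IsSchrodingerSolution.of_isACPrimitive
      (fun x hx => hconj _ (fun x => φ' x t) x (hφ.1 x hx)) ?_
    refine ((hφ.isACPrimitive hV).2.map (Complex.conjCLE : ℂ →L[ℝ] ℂ)).congr
      (fun x _ => by simp) (fun x _ => by simp)
  have hreal := hφc.eq_of_eq_zero hφ hV (by simp [hp]) (by simp [hp']) hx
  have hm : ψp x t = (starRingEnd ℂ) (ψm x t) := hψ.conj t ht x hx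
  have hm' : ψp' x t = (starRingEnd ℂ) (ψm' x t) := by
    have h1 := (hψ.sol_plus t htD).1 x hx
    have h2 : HasDerivWithinAt (fun x => ψp x t) ((starRingEnd ℂ) (ψm' x t)) (Ici 0) x :=
      (hconj _ (fun x => ψm' x t) x ((hψ.sol_minus t htD).1 x hx)).congr
        (fun y hy => hψ.conj t ht y hy) hm
    exact (uniqueDiffOn_Ici (0 : ℝ) x hx).eq_deriv _ h1 h2
  obtain ⟨r, -, hr⟩ := hψ.wronskian_on_bands t ht
  have hW : blochWronskian ψp ψp' ψm ψm' t = Complex.I * r := hr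
  simp only [amplitudePlus, amplitudeMinus, hW, hm, hm', map_div₀, map_sub, map_mul,
    Complex.conj_conj, hreal.1, hreal.2, Complex.conj_I, Complex.conj_ofReal]
  rw [neg_mul, div_neg, ← neg_div, neg_sub]

end Limits

/-! ### The asymptotics of the regular solution -/

theorem mainTheorem2 (a : ℝ) (ha : 0 < a) (q q₁ : ℝ → ℝ) (c ω δ γ α : ℝ)
    (hq_periodic : Function.Periodic q a) (hq : IntervalIntegrable q volume 0 a)
    (hq₁ : IntegrableOn q₁ (Ioi 0))
    (hγ : γ ∈ Ioc (1 / 2 : ℝ) 1) (hα : α ∈ Ico 0 Real.pi)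
    (hω : ∀ j : ℤ, 2 * a * ω / Real.pi ≠ j)
    -- periodic eigenvalues, antiperiodic eigenvalues, quasi-momentum, Bloch solutions
    (l m : ℕ → ℝ) (hl : IsEigenvalueSequence q a 1 l) (hm : IsEigenvalueSequence q a (-1) m)
    (k : ℂ → ℂ) (hk : IsQuasiMomentum q a l m k)
    (ψp ψp' ψm ψm' : ℝ → ℂ → ℂ) (hψ : IsBlochPair q a l m k ψp ψp' ψm ψm')
    -- the solution of the Cauchy problem and its derivative
    (φ φ' : ℝ → ℂ → ℂ)
    (hφ : ∀ z : ℂ, IsSchrodingerSolution (perturbedPotential q q₁ c ω δ γ) z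
      (fun x => φ x z) (fun x => φ' x z))
    (hφ0 : ∀ z : ℂ, φ 0 z = Real.sin α) (hφ0' : ∀ z : ℂ, φ' 0 z = Real.cos α) :
    ∃ A : ℂ → ℂ,
      (∀ β : ℝ, 0 < β →
        (∀ z ∈ upperHalf ∩ sectorUnion a ω l m k β,
          ((fun x : ℝ => φ x z - A z * ψm x z)
            =o[atTop] (fun x : ℝ => Real.exp ((k z).im * (x / a)))) ∧
          ((fun x : ℝ => φ' x z - A z * ψm' x z)
            =o[atTop] (fun x : ℝ => Real.exp ((k z).im * (x / a))))) ∧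
        AnalyticOnNhd ℂ A (interior (sectorUnion a ω l m k β))) ∧
      ∀ μ ∈ regularSpectrum a ω l m k,
        ((fun x : ℝ => φ x μ - (A μ * ψm x μ + (starRingEnd ℂ) (A μ) * ψp x μ))
          =o[atTop] (fun _ : ℝ => (1 : ℝ))) ∧
        ((fun x : ℝ => φ' x μ - (A μ * ψm' x μ + (starRingEnd ℂ) (A μ) * ψp' x μ))
          =o[atTop] (fun _ : ℝ => (1 : ℝ))) ∧
        ∀ M : ℝ, 0 < M → Tendsto A (𝓝[stolzSector μ M] (μ : ℂ)) (𝓝 (A μ)) := by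
  have hq' : ∀ x, 0 ≤ x → IntervalIntegrable q volume 0 x := fun x _ =>
    hq_periodic.intervalIntegrable₀ ha.ne' hq 0 x
  have hV : ∀ x, 0 ≤ x → IntervalIntegrable (perturbedPotential q q₁ c ω δ γ) volume 0 x :=
    fun x hx => intervalIntegrable_perturbedPotential hq' hq₁ hx
  have hφf : IsFixedDataFamily (perturbedPotential q q₁ c ω δ γ) univ (Real.sin α : ℝ)
      (Real.cos α : ℝ) φ φ' := ⟨fun z _ => hφ z, fun z _ => hφ0 z, fun z _ => hφ0' z⟩
  set D := nonresonantDomain a ω l m k with hD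
  have hsub : D ⊆ blochDomain l m := nonresonantDomain_subset_blochDomain a ω l m k
  have hup : upperHalf ⊆ D := subset_union_left
  set F := amplitudeMinus ψp ψp' ψm ψm' φ φ' with hF
  set G := amplitudePlus ψp ψp' ψm ψm' φ φ' with hG
  have hreg := fun x (hx : 0 ≤ x) => hψ.amplitude_regular hq' hV hφf hx
  have hloc := fun z₀ (hz₀ : z₀ ∈ D) => hψ.amplitude_locally_uniform ha hq' hq₁ hγ.1 hk hl hω hφ
    (fun x hx => (hreg x hx).1) (fun x hx => (hreg x hx).2.1) hz₀
  -- the limit exists on all of `D`; elsewhere the value of `A` is irrelevant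
  set A : ℂ → ℂ := fun z => limUnder atTop fun x => F x z with hA
  have hlim : ∀ z ∈ D, Tendsto (fun x => F x z) atTop (𝓝 (A z)) := by
    intro z hz
    obtain ⟨X₀, -, τ, hτ, hev⟩ := hloc z hz
    have hz' := hev.self_of_nhdsWithin hz
    obtain ⟨b, hb, -⟩ := exists_limit_of_increments hτ fun x y hx hxy => (hz' x y hx hxy).1
    exact tendsto_nhds_limUnder ⟨b, hb⟩
  have hunif : TendstoLocallyUniformlyOn F A atTop D := by
    rw [Metric.tendstoLocallyUniformlyOn_iff]
    intro ε hε z₀ hz₀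
    obtain ⟨X₀, -, τ, hτ, hev⟩ := hloc z₀ hz₀
    refine ⟨_, inter_mem hev self_mem_nhdsWithin, ?_⟩
    filter_upwards [hτ.eventually (Iio_mem_nhds hε), eventually_ge_atTop X₀] with x hx hxX z hz
    obtain ⟨b, hb, hbτ⟩ := exists_limit_of_increments hτ fun x y hx hxy => (hz.1 x y hx hxy).1
    rw [dist_eq_norm, tendsto_nhds_unique (hlim z hz.2) hb]
    exact (hbτ x hxX).trans_lt hx
  have hAcont : ContinuousOn A D := by
    refine hunif.continuousOn (Eventually.frequently ?_)
    filter_upwards [eventually_ge_atTop (0 : ℝ)] with x hx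
    exact (hreg x hx).1.mono hsub
  have hAdiff : DifferentiableOn ℂ A upperHalf := by
    refine (hunif.mono hup).differentiableOn ?_ isOpen_upperHalf
    filter_upwards [eventually_ge_atTop (0 : ℝ)] with x hx
    exact (hreg x hx).2.2
  refine ⟨A, fun β _ => ⟨fun z hz => ?_, ?_⟩, fun μ hμ => ?_⟩
  · have hzD := hup hz.1
    have hzB := hsub hzD
    have hκ : 0 < (k z).im / a := div_pos (hk.maps_upper z hz.1) ha
    obtain ⟨K, hK⟩ := hψ.exists_norm_le ha hq' hzB
    obtain ⟨X₀, -, τ, hτ, hev⟩ := hloc z hzD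
    have hB := tendsto_zero_of_weighted_increments (F := fun x => G x z)
      (κ := 2 * ((k z).im / a)) (by positivity) hτ fun x y hx hxy => by
        have := (hev.self_of_nhdsWithin hzD x y hx hxy).2
        rwa [mul_div_assoc] at this
    have hB' : Tendsto (fun x => Real.exp (-(2 * ((k z).im / a)) * x) * ‖G x z - 0‖) atTop
        (𝓝 0) := by simpa using hB
    have hexp : (fun x : ℝ => Real.exp ((k z).im * (x / a))) =
        fun x : ℝ => Real.exp ((k z).im / a * x) := by
      funext x
      congr 1
      ring
    rw [hexp]
    have hrep := fun x (hx : 0 ≤ x) => hψ.amplitude_representation hq' φ φ' hzB hx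
    constructor
    · simpa using isLittleO_of_amplitudes (fun x hx => (hrep x hx).1)
        (fun x hx => (hK x hx).2.2.1) (fun x hx => (hK x hx).1) (hlim z hzD) hB'
    · simpa using isLittleO_of_amplitudes (fun x hx => (hrep x hx).2)
        (fun x hx => (hK x hx).2.2.2) (fun x hx => (hK x hx).2.1) (hlim z hzD) hB'
  -- the interior of `U(β)` lies in the open half-plane, where `A` is already analytic
  · refine (hAdiff.analyticOnNhd isOpen_upperHalf).mono ?_
    have h1 : sectorUnion a ω l m k β ⊆ {z : ℂ | 0 ≤ z.im} :=
      iUnion₂_subset fun _ _ _ hz => hz.1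
    refine (interior_mono h1).trans ?_
    rw [Complex.interior_setOfPred_le_im]
    exact fun z hz => hz
  · have hμD : (μ : ℂ) ∈ D := Or.inr ⟨μ, hμ, rfl⟩
    have hμB := hsub hμD
    have him : (k μ).im = 0 := hk.real_on_spectrum μ hμ.1.1
    obtain ⟨K, hK⟩ := hψ.exists_norm_le ha hq' hμB
    -- here `Im k = 0`: the weight is trivial and `B`, too, converges to a nonzero limit in general
    have hB : Tendsto (fun x => G x μ) atTop (𝓝 ((starRingEnd ℂ) (A μ))) := by
      refine ((Complex.continuous_conj.tendsto _).comp (hlim μ hμD)).congr' ?_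
      filter_upwards [eventually_ge_atTop (0 : ℝ)] with x hx
      exact (hψ.amplitudePlus_eq_conj hV (hφ μ) (hφ0 μ) (hφ0' μ) hμ.1 hx).symm
    have hB' : Tendsto (fun x => Real.exp (-(2 * ((k μ).im / a)) * x) *
        ‖G x μ - (starRingEnd ℂ) (A μ)‖) atTop (𝓝 0) := by
      simpa [him] using (hB.sub_const ((starRingEnd ℂ) (A μ))).norm
    have hexp : (fun _ : ℝ => (1 : ℝ)) = fun x : ℝ => Real.exp ((k μ).im / a * x) := by
      funext x
      simp [him]
    rw [hexp]
    have hrep := fun x (hx : 0 ≤ x) => hψ.amplitude_representation hq' φ φ' hμB hx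
    refine ⟨?_, ?_, fun M _ => ?_⟩
    · exact isLittleO_of_amplitudes (fun x hx => (hrep x hx).1)
        (fun x hx => (hK x hx).2.2.1) (fun x hx => (hK x hx).1) (hlim μ hμD) hB'
    · exact isLittleO_of_amplitudes (fun x hx => (hrep x hx).2)
        (fun x hx => (hK x hx).2.2.2) (fun x hx => (hK x hx).2.1) (hlim μ hμD) hB'
    · exact (hAcont μ hμD).tendsto.mono_left
        (nhdsWithin_mono _ fun z hz => hup (show z ∈ upperHalf from hz.1))
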